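/- Let $\mathbb F\in\{\mathbb R,\mathbb C\}$. Let $G$ be an étale groupoid (not necessarily Hausdorff) with locally compact Hausdorff unit space $X$, with domain and range maps $d,r$, and let $\mathcal L=\bigsqcup_{\gamma\in G}L_\gamma$ be a twist over $G$, i.e. a Fell line bundle over $\mathbb F$. Let $\mathfrak C_c(G,\mathcal L)$ be the linear span of the continuous compactly supported sections of $\mathcal L|_U$, extended by zero, over open bisections $U\subseteq G$, with the convolution product $(f*g)(\gamma)=\sum_{r(\eta)=r(\gamma)}f(\eta)\cdot g(\eta^{-1}\gamma)$. Put $$\|f\|_{d_*}=\sup_{x\in X}\sum_{d(\gamma)=x}|f(\gamma)|,\qquad \|f\|_{r_*}=\sup_{x\in X}\sum_{r(\gamma)=x}|f(\gamma)|,\qquad \|f\|_I=\max\{\|f\|_{d_*},\|f\|_{r_*}\},$$ and let $F(G,\mathcal L)$ be the Banach algebra completion of $\mathfrak C_c(G,\mathcal L)$ in the norm $\|f\|_{\max}=\inf\{\sum_{k=1}^n\|f_k\|_\infty\}$, the infimum being over all decompositions $f=\sum_{k=1}^n f_k$ into continuous compactly supported sections $f_k$ over open bisections $U_k$. Let $p,q\in[1,\infty]$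 with $1/p+1/q=1$ (where $1/\infty=0$), and let $\ell^p(G,\mathcal L)$ be the Banach space of all $p$-summable (bounded, if $p=\infty$) sections of $\mathcal L$, with its usual norm. Then the formula $\Lambda_p(f)\xi=f*\xi$, for $f\in\mathfrak C_c(G,\mathcal L)$ and $\xi\in\ell^p(G,\mathcal L)$, defines a unique contractive algebra homomorphism $\Lambda_p:F(G,\mathcal L)\to B(\ell^p(G,\mathcal L))$. It is injective on $\mathfrak C_c(G,\mathcal L)$, and: 1. for all $f\in\mathfrak C_c(G,\mathcal L)$ we have $\|\Lambda_p(f)\|\le\|f\|_{d_*}^{1/p}\,\|f\|_{r_*}^{1/q}\le\|f\|_I$ (with $t^0=1$ for all $t\ge 0$), while $\|\Lambda_1(f)\|=\|f\|_{d_*}$ and $\|\Lambda_\infty(f)\|=\|f\|_{r_*}$; 2. put $F^p_{\mathrm{red}}(G,\mathcal L)=\overline{\Lambda_p(\mathfrak C_c(G,\mathcal L))}$, and let $\mathcal L^{\mathrm{op}}$ be the opposite twist, with fibers $L^{\mathrm{op}}_\gamma=L_{\gamma^{-1}}$, multiplication $(z,w)\mapsto w\cdot z$, the involution of $\mathcal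 L$, and the topology that makes $\mathcal L^{\mathrm{op}}$ the pullback of $\mathcal L$ along $\gamma\mapsto\gamma^{-1}$. Then the map $f\mapsto\check f$, $\check f(\gamma)=f(\gamma^{-1})$, induces an isometric algebra isomorphism $F^p_{\mathrm{red}}(G,\mathcal L)^{\mathrm{op}}\cong F^q_{\mathrm{red}}(G,\mathcal L^{\mathrm{op}})$. In particular, for the trivial twist it induces an isometric isomorphism $F^p_{\mathrm{red}}(G)^{\mathrm{op}}\cong F^q_{\mathrm{red}}(G)$. -/

import Mathlib

open CategoryTheory Bundle Topology
open scoped ENNReal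

universe u v w

/-! ## Étale groupoids -/

namespace Arr

variable {X : Type u} [Groupoid.{v} X]

/-- The product `αβ` of two arrows that are composable in the sense that the domain of `α`
(its `left` end) is the range of `β` (its `right` end). -/
def comp (α β : Quiver.Total X) (h : α.left = β.right) : Quiver.Total X :=
  ⟨β.left, α.right, β.hom ≫ eqToHom h.symm ≫ α.hom⟩

/-- The inverse arrow. -/
def inv (α : Quiver.Total X) : Quiver.Total X :=
  ⟨α.right, α.left, Groupoid.inv α.hom⟩

/-- The unit arrow at an object; it identifies `X` with the unit space. -/
def unit (x : X) : Quiver.Total X := ⟨x, x, 𝟙 x⟩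

/-- `α` and `β` are composable and their product is `γ`. -/
def IsComp (α β γ : Quiver.Total X) : Prop :=
  ∃ h : α.left = β.right, comp α β h = γ

theorem isComp_comp (α β : Quiver.Total X) (h : α.left = β.right) :
    IsComp α β (comp α β h) := ⟨h, rfl⟩

theorem isComp_iff {α β γ : Quiver.Total X} : IsComp α β γ ↔
    ∃ (x y z : X) (g : x ⟶ y) (f : y ⟶ z),
      α = ⟨y, z, f⟩ ∧ β = ⟨x, y, g⟩ ∧ γ = ⟨x, z, g ≫ f⟩ := by
  constructor
  · rintro ⟨h, rfl⟩
    obtain ⟨y, z, f⟩ := α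
    obtain ⟨x, y', g⟩ := β
    dsimp at h
    subst h
    exact ⟨x, y, z, g, f, rfl, rfl, by simp [comp]⟩
  · rintro ⟨x, y, z, g, f, rfl, rfl, rfl⟩
    exact ⟨rfl, by simp [comp]⟩

theorem IsComp.left_eq {α β γ : Quiver.Total X} (h : IsComp α β γ) : γ.left = β.left := by
  obtain ⟨x, y, z, g, f, rfl, rfl, rfl⟩ := isComp_iff.1 h; rfl

theorem IsComp.right_eq {α β γ : Quiver.Total X} (h : IsComp α β γ) : γ.right = α.right := by
  obtain ⟨x, y, z, g, f, rfl, rfl, rfl⟩ := isComp_iff.1 h; rfl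

theorem IsComp.inv {α β γ : Quiver.Total X} (h : IsComp α β γ) :
    IsComp (inv β) (inv α) (inv γ) := by
  obtain ⟨x, y, z, g, f, rfl, rfl, rfl⟩ := isComp_iff.1 h
  exact isComp_iff.2 ⟨z, y, x, _, _, rfl, rfl, by simp [Arr.inv]⟩

theorem IsComp.unique {α β γ γ' : Quiver.Total X} (h : IsComp α β γ) (h' : IsComp α β γ') :
    γ = γ' := by
  obtain ⟨_, rfl⟩ := h
  obtain ⟨_, rfl⟩ := h'
  rfl

theorem IsComp.unique_right {α β β' γ : Quiver.Total X} (h : IsComp α β γ)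
    (h' : IsComp α β' γ) : β = β' := by
  obtain ⟨x, y, z, g, f, rfl, rfl, rfl⟩ := isComp_iff.1 h
  obtain ⟨x', y', z', g', f', h1, rfl, h3⟩ := isComp_iff.1 h'
  injection h1 with h11 h12 h13
  subst h11; subst h12
  have := eq_of_heq h13
  subst this
  injection h3 with h31 h32 h33
  subst h31
  have := eq_of_heq h33
  rw [cancel_mono] at this
  subst this
  rfl

theorem inv_inv (α : Quiver.Total X) : inv (inv α) = α := by
  simp [inv]

theorem inv_injective : Function.Injective (inv : Quiver.Total X → Quiver.Total X) :=
  Function.LeftInverse.injective inv_inv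

/-- `η⁻¹γ` for arrows with the same range. -/
def ldiv (η γ : Quiver.Total X) (h : η.right = γ.right) : Quiver.Total X :=
  comp (inv η) γ h

theorem isComp_ldiv (η γ : Quiver.Total X) (h : η.right = γ.right) :
    IsComp η (ldiv η γ h) γ := by
  obtain ⟨y, z, f⟩ := η
  obtain ⟨x, z', k⟩ := γ
  dsimp at h
  subst h
  refine isComp_iff.2 ⟨x, y, z, k ≫ Groupoid.inv f, f, rfl, ?_, by simp⟩
  simp [ldiv, comp, inv]
  exact Category.comp_id k

theorem isComp_assoc {α β γ δ ε : Quiver.Total X} (h : IsComp α β δ) (h' : IsComp δ γ ε) :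
    ∃ ζ, IsComp β γ ζ ∧ IsComp α ζ ε := by
  obtain ⟨x, y, z, g, f, rfl, rfl, rfl⟩ := isComp_iff.1 h
  obtain ⟨x', y', z', g', f', h1, rfl, rfl⟩ := isComp_iff.1 h'
  injection h1 with h11 h12 h13
  subst h11; subst h12
  have := eq_of_heq h13
  subst this
  exact ⟨⟨x', y, g' ≫ g⟩, isComp_iff.2 ⟨_, _, _, _, _, rfl, rfl, rfl⟩,
    isComp_iff.2 ⟨_, _, _, _, _, rfl, rfl, by simp⟩⟩

theorem isComp_assoc' {α β γ ζ ε : Quiver.Total X} (h : IsComp β γ ζ) (h' : IsComp α ζ ε) :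
    ∃ δ, IsComp α β δ ∧ IsComp δ γ ε := by
  obtain ⟨x, y, z, g, f, rfl, rfl, rfl⟩ := isComp_iff.1 h
  obtain ⟨x', y', z', g', f', rfl, h1, rfl⟩ := isComp_iff.1 h'
  injection h1 with h11 h12 h13
  subst h11; subst h12
  have := eq_of_heq h13
  subst this
  exact ⟨⟨y, z', f ≫ f'⟩, isComp_iff.2 ⟨_, _, _, _, _, rfl, rfl, rfl⟩,
    isComp_iff.2 ⟨_, _, _, _, _, rfl, rfl, by simp⟩⟩

end Arr

/-- The groupoid `X`, with the given topologies on its objects and on its arrows, is an étale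
topological groupoid: composition, inversion and units are continuous, and domain and range are
local homeomorphisms. Then `x ↦ Arr.unit x` is a homeomorphism from `X` onto the set of unit
arrows. -/
class IsEtaleGroupoid (X : Type u) [TopologicalSpace X] [Groupoid.{v} X]
    [TopologicalSpace (Quiver.Total X)] : Prop where
  continuous_comp : Continuous
    fun p : {p : Quiver.Total X × Quiver.Total X // p.1.left = p.2.right} =>
      Arr.comp p.1.1 p.1.2 p.2
  continuous_inv : Continuous (Arr.inv : Quiver.Total X → Quiver.Total X)
  continuous_unit : Continuous (Arr.unit : X → Quiver.Total X)
  isLocalHomeomorph_left : IsLocalHomeomorph (Quiver.Total.left : Quiver.Total X → X)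
  isLocalHomeomorph_right : IsLocalHomeomorph (Quiver.Total.right : Quiver.Total X → X)

/-- Open bisections. -/
structure IsBisection {X : Type u} [TopologicalSpace X] [Groupoid.{v} X]
    [TopologicalSpace (Quiver.Total X)] (U : Set (Quiver.Total X)) : Prop where
  isOpen : IsOpen U
  left : IsOpenEmbedding (U.domRestrict Quiver.Total.left)
  right : IsOpenEmbedding (U.domRestrict Quiver.Total.right)

/-! ## Twists -/

/-- A twist over a topological groupoid: a line bundle over the arrows, that is, a family of
one-dimensional normed spaces with a topology on the total space for which the projection is
continuous and open and addition, scalar multiplication and norm are continuous, together with a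
continuous associative multiplication and a continuous involution. -/
structure Twist (𝕜 : Type) [RCLike 𝕜] (X : Type u) [TopologicalSpace X] [Groupoid.{v} X]
    [TopologicalSpace (Quiver.Total X)] where
  fiber : Quiver.Total X → Type w
  [normedAddCommGroup : ∀ γ, NormedAddCommGroup (fiber γ)]
  [normedSpace : ∀ γ, NormedSpace 𝕜 (fiber γ)]
  finrank_fiber : ∀ γ, Module.finrank 𝕜 (fiber γ) = 1
  [topology : TopologicalSpace (TotalSpace 𝕜 fiber)]
  continuous_proj : Continuous (TotalSpace.proj : TotalSpace 𝕜 fiber → Quiver.Total X)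
  isOpenMap_proj : IsOpenMap (TotalSpace.proj : TotalSpace 𝕜 fiber → Quiver.Total X)
  continuous_add : Continuous fun z : TotalSpace (𝕜 × 𝕜) (fiber ×ᵇ fiber) =>
    (⟨z.proj, z.snd.1 + z.snd.2⟩ : TotalSpace 𝕜 fiber)
  continuous_smul : Continuous fun z : 𝕜 × TotalSpace 𝕜 fiber =>
    (⟨z.2.proj, z.1 • z.2.snd⟩ : TotalSpace 𝕜 fiber)
  continuous_norm : Continuous fun z : TotalSpace 𝕜 fiber => ‖z.snd‖
  /-- The bilinear multiplication maps `L_α × L_β → L_γ`, where `γ = αβ`. -/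
  mul : ∀ {α β γ : Quiver.Total X}, Arr.IsComp α β γ → fiber α →ₗ[𝕜] fiber β →ₗ[𝕜] fiber γ
  continuous_mul : Continuous fun z : {z : TotalSpace 𝕜 fiber × TotalSpace 𝕜 fiber //
      z.1.proj.left = z.2.proj.right} =>
    (⟨Arr.comp z.1.1.proj z.1.2.proj z.2,
      mul (Arr.isComp_comp _ _ z.2) z.1.1.snd z.1.2.snd⟩ : TotalSpace 𝕜 fiber)
  mul_assoc : ∀ {α β γ δ ζ ε : Quiver.Total X} (h₁ : Arr.IsComp α β δ) (h₂ : Arr.IsComp δ γ ε)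
    (h₃ : Arr.IsComp β γ ζ) (h₄ : Arr.IsComp α ζ ε) (a : fiber α) (b : fiber β) (c : fiber γ),
    mul h₂ (mul h₁ a b) c = mul h₄ a (mul h₃ b c)
  norm_mul : ∀ {α β γ : Quiver.Total X} (h : Arr.IsComp α β γ) (a : fiber α) (b : fiber β),
    ‖mul h a b‖ = ‖a‖ * ‖b‖
  /-- The conjugate linear involution maps `L_γ → L_{γ⁻¹}`. -/
  star : ∀ γ : Quiver.Total X, fiber γ →ₛₗ[starRingEnd 𝕜] fiber (Arr.inv γ)
  continuous_star : Continuous fun z : TotalSpace 𝕜 fiber =>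
    (⟨Arr.inv z.proj, star z.proj z.snd⟩ : TotalSpace 𝕜 fiber)
  star_star : ∀ (γ : Quiver.Total X) (z : fiber γ),
    (⟨Arr.inv (Arr.inv γ), star _ (star γ z)⟩ : TotalSpace 𝕜 fiber) = ⟨γ, z⟩
  norm_star : ∀ (γ : Quiver.Total X) (z : fiber γ), ‖star γ z‖ = ‖z‖
  star_mul : ∀ {α β γ : Quiver.Total X} (h : Arr.IsComp α β γ) (a : fiber α) (b : fiber β),
    star γ (mul h a b) = mul h.inv (star β b) (star α a)
  /-- `z z* = |z|²` in `L_{r(γ)} ≅ 𝕜`: the element `z z*` of the one-dimensional algebra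
  `L_{r(γ)}` is `|z|²` times its unit, the unit being the element that acts as the identity
  on every fiber over an arrow with range `r(γ)`. -/
  mul_star_self : ∀ {γ ε δ : Quiver.Total X} (h : Arr.IsComp γ (Arr.inv γ) ε)
    (h' : Arr.IsComp ε δ δ) (z : fiber γ) (b : fiber δ),
    mul h' (mul h z (star γ z)) b = ((‖z‖ : 𝕜) ^ 2) • b

attribute [instance] Twist.normedAddCommGroup Twist.normedSpace Twist.topology

namespace Twist

variable {𝕜 : Type} [RCLike 𝕜] {X : Type u} [TopologicalSpace X] [Groupoid.{v} X]
  [TopologicalSpace (Quiver.Total X)]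

section Basic

variable (L : Twist.{u, v, w} 𝕜 X)

/-- Sections of the bundle, with no continuity required. -/
abbrev Section : Type (max u v w) := ∀ γ : Quiver.Total X, L.fiber γ

theorem mk_mul_eq {α β γ γ' : Quiver.Total X} (h : Arr.IsComp α β γ) (h' : Arr.IsComp α β γ')
    (a : L.fiber α) (b : L.fiber β) :
    (⟨γ, L.mul h a b⟩ : TotalSpace 𝕜 L.fiber) = ⟨γ', L.mul h' a b⟩ := by
  obtain rfl := h.unique h'
  rfl

theorem mk_star_congr {γ γ' : Quiver.Total X} {a : L.fiber γ} {a' : L.fiber γ'}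
    (h : (⟨γ, a⟩ : TotalSpace 𝕜 L.fiber) = ⟨γ', a'⟩) :
    (⟨_, L.star _ a⟩ : TotalSpace 𝕜 L.fiber) = ⟨_, L.star _ a'⟩ := by
  cases h
  rfl

theorem mul_congr {α α' β β' γ : Quiver.Total X} {a : L.fiber α} {a' : L.fiber α'}
    {b : L.fiber β} {b' : L.fiber β'}
    (ha : (⟨α, a⟩ : TotalSpace 𝕜 L.fiber) = ⟨α', a'⟩)
    (hb : (⟨β, b⟩ : TotalSpace 𝕜 L.fiber) = ⟨β', b'⟩) (h : Arr.IsComp α β γ)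
    (h' : Arr.IsComp α' β' γ) : L.mul h a b = L.mul h' a' b' := by
  cases ha
  cases hb
  rfl

/-- `f` is a continuous compactly supported section over `U`, extended by zero outside `U`. -/
structure IsCcOn (U : Set (Quiver.Total X)) (f : L.Section) : Prop where
  continuousOn : ContinuousOn (fun γ => (⟨γ, f γ⟩ : TotalSpace 𝕜 L.fiber)) U
  compact : ∃ K ⊆ U, IsCompact K ∧ ∀ γ ∉ K, f γ = 0

/-- The space `𝔠_c(G, L)` of quasi-continuous compactly supported sections. -/
def Cc : Submodule 𝕜 L.Section :=
  Submodule.span 𝕜 {f | ∃ U, IsBisection U ∧ L.IsCcOn U f}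

/-- The convolution `(f * g)(γ) = ∑_{r(η) = r(γ)} f(η) · g(η⁻¹γ)`. If `f` is in `L.Cc`, then only
finitely many terms of the sum are nonzero. -/
noncomputable def conv (f g : L.Section) : L.Section := fun γ =>
  ∑ᶠ η : {η : Quiver.Total X // η.right = γ.right},
    L.mul (Arr.isComp_ldiv η.1 γ η.2) (f η.1) (g (Arr.ldiv η.1 γ η.2))

/-- The norm `‖f‖_{d*} = sup_x ∑_{d(γ) = x} |f(γ)|`. -/
noncomputable def normD (f : L.Section) : ℝ≥0∞ :=
  ⨆ x : X, ∑' γ : {γ : Quiver.Total X // γ.left = x}, ‖f γ.1‖ₑ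

/-- The norm `‖f‖_{r*} = sup_x ∑_{r(γ) = x} |f(γ)|`. -/
noncomputable def normR (f : L.Section) : ℝ≥0∞ :=
  ⨆ x : X, ∑' γ : {γ : Quiver.Total X // γ.right = x}, ‖f γ.1‖ₑ

/-- The norm `‖f‖_I = max {‖f‖_{d*}, ‖f‖_{r*}}`. -/
noncomputable def normI (f : L.Section) : ℝ≥0∞ := max (L.normD f) (L.normR f)

/-- The norm `‖f‖_max`: the infimum of `∑ ‖f_k‖_∞` over all the ways to write `f` as a finite sum
of continuous compactly supported sections `f_k` over bisections `U_k`. -/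
noncomputable def maxNorm (f : L.Section) : ℝ :=
  sInf {s | ∃ (n : ℕ) (U : Fin n → Set (Quiver.Total X)) (g : Fin n → L.Section),
    (∀ k, IsBisection (U k) ∧ L.IsCcOn (U k) (g k)) ∧ f = ∑ k, g k ∧
      s = ∑ k, ⨆ γ, ‖g k γ‖}

end Basic

/-! ### The convolution algebra -/

section Algebra

variable {L : Twist.{u, v, w} 𝕜 X}

theorem conv_eq_of_unique {f g : L.Section} {α β γ : Quiver.Total X} (h : Arr.IsComp α β γ)
    (hf : ∀ η : Quiver.Total X, η.right = γ.right → f η ≠ 0 → η = α) :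
    L.conv f g γ = L.mul h (f α) (g β) := by
  have hr := h.right_eq
  have hb : β = Arr.ldiv α γ hr.symm := h.unique_right (Arr.isComp_ldiv _ _ _)
  subst hb
  unfold conv
  rw [finsum_eq_single _ (⟨α, hr.symm⟩ : {η : Quiver.Total X // η.right = γ.right})]
  intro η hη
  by_cases h0 : f η.1 = 0
  · simp [h0]
  · exact absurd (Subtype.ext (hf η.1 η.2 h0)) hη

theorem conv_eq_zero {f g : L.Section} {γ : Quiver.Total X}
    (hf : ∀ α β, Arr.IsComp α β γ → f α ≠ 0 → g β = 0) : L.conv f g γ = 0 := by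
  unfold conv
  refine finsum_eq_zero_of_forall_eq_zero fun η => ?_
  by_cases h0 : f η.1 = 0
  · simp [h0]
  · rw [hf _ _ (Arr.isComp_ldiv η.1 γ η.2) h0, map_zero]

theorem IsCcOn.eq_zero {U : Set (Quiver.Total X)} {f : L.Section} (hf : L.IsCcOn U f)
    {γ : Quiver.Total X} (h : γ ∉ U) : f γ = 0 := by
  obtain ⟨K, hK, -, h0⟩ := hf.compact
  exact h0 γ fun h' => h (hK h')

theorem IsCcOn.mem_of_ne {U : Set (Quiver.Total X)} {f : L.Section} (hf : L.IsCcOn U f)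
    {γ : Quiver.Total X} (h : f γ ≠ 0) : γ ∈ U := by
  by_contra h'
  exact h (hf.eq_zero h')

theorem IsCcOn.smul {U : Set (Quiver.Total X)} {f : L.Section} (hf : L.IsCcOn U f) (c : 𝕜) :
    L.IsCcOn U (c • f) := by
  obtain ⟨K, hK, hc, h0⟩ := hf.compact
  refine ⟨?_, K, hK, hc, fun γ hγ => by simp [h0 γ hγ]⟩
  exact L.continuous_smul.comp_continuousOn (continuousOn_const.prodMk hf.continuousOn)

theorem IsCcOn.bddAbove {U : Set (Quiver.Total X)} {f : L.Section} (hf : L.IsCcOn U f) :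
    BddAbove (Set.range fun γ => ‖f γ‖) := by
  obtain ⟨K, hK, hc, h0⟩ := hf.compact
  have hcont : ContinuousOn (fun γ => ‖f γ‖) K :=
    L.continuous_norm.comp_continuousOn (hf.continuousOn.mono hK)
  obtain ⟨C, hC⟩ := hc.bddAbove_image hcont
  refine ⟨max C 0, ?_⟩
  rintro _ ⟨γ, rfl⟩
  by_cases h : γ ∈ K
  · exact le_max_of_le_left (hC ⟨γ, h, rfl⟩)
  · simp [h0 γ h]

theorem _root_.IsBisection.injOn_left {U : Set (Quiver.Total X)} (hU : IsBisection U) :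
    Set.InjOn Quiver.Total.left U :=
  Set.injOn_iff_injective.2 hU.left.injective

theorem _root_.IsBisection.injOn_right {U : Set (Quiver.Total X)} (hU : IsBisection U) :
    Set.InjOn Quiver.Total.right U :=
  Set.injOn_iff_injective.2 hU.right.injective

theorem finite_support_of_mem {f : L.Section} (hf : f ∈ L.Cc) (x : X) :
    {η : Quiver.Total X | η.right = x ∧ f η ≠ 0}.Finite := by
  induction hf using Submodule.span_induction with
  | mem f hf =>
    obtain ⟨U, hU, hfU⟩ := hf
    refine Set.Subsingleton.finite ?_
    rintro η ⟨h1, h2⟩ η' ⟨h1', h2'⟩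
    exact hU.injOn_right (hfU.mem_of_ne h2) (hfU.mem_of_ne h2') (h1.trans h1'.symm)
  | zero => simp
  | add f g _ _ hf hg =>
    refine (hf.union hg).subset ?_
    rintro η ⟨h1, h2⟩
    by_cases h : f η = 0
    · exact Or.inr ⟨h1, fun h' => h2 (by simp [h, h'])⟩
    · exact Or.inl ⟨h1, h⟩
  | smul c f _ hf =>
    refine hf.subset ?_
    rintro η ⟨h1, h2⟩
    exact ⟨h1, fun h' => h2 (by simp [h'])⟩

theorem finite_conv_support {f : L.Section} (hf : f ∈ L.Cc) (g : L.Section)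
    (γ : Quiver.Total X) :
    (Function.support fun η : {η : Quiver.Total X // η.right = γ.right} =>
      L.mul (Arr.isComp_ldiv η.1 γ η.2) (f η.1) (g (Arr.ldiv η.1 γ η.2))).Finite := by
  refine Set.Finite.subset
    ((finite_support_of_mem hf γ.right).preimage Subtype.val_injective.injOn) ?_
  intro η hη
  refine ⟨η.2, fun h => hη ?_⟩
  simp [h]

theorem conv_add_left {f f' : L.Section} (hf : f ∈ L.Cc) (hf' : f' ∈ L.Cc) (g : L.Section) :
    L.conv (f + f') g = L.conv f g + L.conv f' g := by
  funext γ
  simp only [conv, Pi.add_apply]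
  rw [← finsum_add_distrib (finite_conv_support hf g γ) (finite_conv_support hf' g γ)]
  simp

theorem conv_add_right {f : L.Section} (hf : f ∈ L.Cc) (g g' : L.Section) :
    L.conv f (g + g') = L.conv f g + L.conv f g' := by
  funext γ
  simp only [conv, Pi.add_apply]
  rw [← finsum_add_distrib (finite_conv_support hf g γ) (finite_conv_support hf g' γ)]
  simp

theorem conv_smul_left (c : 𝕜) (f g : L.Section) :
    L.conv (c • f) g = c • L.conv f g := by
  funext γ
  simp only [conv, Pi.smul_apply]
  rw [smul_finsum]
  simp

theorem conv_smul_right (c : 𝕜) (f g : L.Section) :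
    L.conv f (c • g) = c • L.conv f g := by
  funext γ
  simp only [conv, Pi.smul_apply]
  rw [smul_finsum]
  simp

theorem conv_zero_left (g : L.Section) : L.conv 0 g = 0 := by
  funext γ
  exact conv_eq_zero fun _ _ _ h => absurd rfl h

theorem conv_zero_right (f : L.Section) : L.conv f 0 = 0 := by
  funext γ
  exact conv_eq_zero fun _ _ _ _ => rfl

/-- The product of two sets of arrows. -/
def _root_.Arr.setMul (U V : Set (Quiver.Total X)) : Set (Quiver.Total X) :=
  {γ | ∃ α ∈ U, ∃ β ∈ V, Arr.IsComp α β γ}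

theorem _root_.IsBisection.exists_section_right {U : Set (Quiver.Total X)} (hU : IsBisection U) :
    IsOpen (Quiver.Total.right '' U) ∧ ∃ s : Quiver.Total.right '' U → Quiver.Total X,
      Continuous s ∧ ∀ x, s x ∈ U ∧ (s x).right = x := by
  have hr : Set.range (U.domRestrict Quiver.Total.right) = Quiver.Total.right '' U :=
    Set.range_domRestrict _ _
  refine ⟨hr ▸ hU.right.isOpen_range, ?_⟩
  rw [← hr]
  let e := hU.right.toIsEmbedding.toHomeomorph
  refine ⟨fun x => (e.symm x).1, continuous_subtype_val.comp e.symm.continuous, fun x => ?_⟩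
  refine ⟨(e.symm x).2, ?_⟩
  exact congrArg Subtype.val (e.apply_symm_apply x)

theorem _root_.IsBisection.exists_section_left {U : Set (Quiver.Total X)} (hU : IsBisection U) :
    IsOpen (Quiver.Total.left '' U) ∧ ∃ s : Quiver.Total.left '' U → Quiver.Total X,
      Continuous s ∧ ∀ x, s x ∈ U ∧ (s x).left = x := by
  have hr : Set.range (U.domRestrict Quiver.Total.left) = Quiver.Total.left '' U :=
    Set.range_domRestrict _ _
  refine ⟨hr ▸ hU.left.isOpen_range, ?_⟩
  rw [← hr]
  let e := hU.left.toIsEmbedding.toHomeomorph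
  refine ⟨fun x => (e.symm x).1, continuous_subtype_val.comp e.symm.continuous, fun x => ?_⟩
  refine ⟨(e.symm x).2, ?_⟩
  exact congrArg Subtype.val (e.apply_symm_apply x)

theorem IsCcOn.conv_apply {U : Set (Quiver.Total X)} {f g : L.Section} (hU : IsBisection U)
    (hf : L.IsCcOn U f) {α β γ : Quiver.Total X} (hα : α ∈ U) (h : Arr.IsComp α β γ) :
    L.conv f g γ = L.mul h (f α) (g β) :=
  conv_eq_of_unique h fun _ hη h0 =>
    hU.injOn_right (hf.mem_of_ne h0) hα (hη.trans h.right_eq)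

section Etale

variable [IsEtaleGroupoid X]

theorem _root_.IsBisection.of_injOn {U : Set (Quiver.Total X)} (hU : IsOpen U)
    (hl : Set.InjOn Quiver.Total.left U) (hr : Set.InjOn Quiver.Total.right U) :
    IsBisection U where
  isOpen := hU
  left := .of_continuous_injective_isOpenMap
    (IsEtaleGroupoid.isLocalHomeomorph_left.continuous.comp continuous_subtype_val)
    (Set.injOn_iff_injective.1 hl)
    (IsEtaleGroupoid.isLocalHomeomorph_left.isOpenMap.comp hU.isOpenMap_subtype_val)
  right := .of_continuous_injective_isOpenMap
    (IsEtaleGroupoid.isLocalHomeomorph_right.continuous.comp continuous_subtype_val)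
    (Set.injOn_iff_injective.1 hr)
    (IsEtaleGroupoid.isLocalHomeomorph_right.isOpenMap.comp hU.isOpenMap_subtype_val)

theorem continuous_left : Continuous (Quiver.Total.left : Quiver.Total X → X) :=
  IsEtaleGroupoid.isLocalHomeomorph_left.continuous

theorem continuous_right : Continuous (Quiver.Total.right : Quiver.Total X → X) :=
  IsEtaleGroupoid.isLocalHomeomorph_right.continuous

theorem isBisection_setMul {U V : Set (Quiver.Total X)} (hU : IsBisection U)
    (hV : IsBisection V) : IsBisection (Arr.setMul U V) := by
  refine IsBisection.of_injOn ?_ ?_ ?_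
  · obtain ⟨ho, s, hs, hsU⟩ := hU.exists_section_right
    let W : Set (Quiver.Total X) := Quiver.Total.right ⁻¹' (Quiver.Total.right '' U)
    have hW : IsOpen W := ho.preimage continuous_right
    let φ : W → Quiver.Total X := fun γ =>
      Arr.ldiv (s ⟨γ.1.right, γ.2⟩) γ.1 (hsU ⟨γ.1.right, γ.2⟩).2
    have hs' : Continuous fun γ : W => s ⟨γ.1.right, γ.2⟩ :=
      hs.comp ((continuous_right.comp continuous_subtype_val).subtype_mk _)
    have hφ : Continuous φ := by
      have h1 : Continuous fun γ : W =>
          (⟨(Arr.inv (s ⟨γ.1.right, γ.2⟩), γ.1), (hsU ⟨γ.1.right, γ.2⟩).2⟩ :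
            {p : Quiver.Total X × Quiver.Total X // p.1.left = p.2.right}) :=
        ((IsEtaleGroupoid.continuous_inv.comp hs').prodMk continuous_subtype_val).subtype_mk _
      exact IsEtaleGroupoid.continuous_comp.comp h1
    have : Arr.setMul U V = Subtype.val '' (φ ⁻¹' V) := by
      ext γ
      constructor
      · rintro ⟨α, hα, β, hβ, h⟩
        have hγ : γ ∈ W := ⟨α, hα, h.right_eq.symm⟩
        refine ⟨⟨γ, hγ⟩, ?_, rfl⟩
        have h1 : s ⟨γ.right, hγ⟩ = α :=
          hU.injOn_right (hsU _).1 hα ((hsU _).2.trans h.right_eq)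
        have h2 : Arr.IsComp α (φ ⟨γ, hγ⟩) γ := by
          have := Arr.isComp_ldiv (s ⟨γ.right, hγ⟩) γ (hsU ⟨γ.right, hγ⟩).2
          exact h1 ▸ this
        change φ ⟨γ, hγ⟩ ∈ V
        rwa [h2.unique_right h]
      · rintro ⟨γ, hγ, rfl⟩
        exact ⟨_, (hsU ⟨γ.1.right, γ.2⟩).1, _, hγ, Arr.isComp_ldiv _ _ _⟩
    rw [this]
    exact hW.isOpenMap_subtype_val _ (hV.isOpen.preimage hφ)
  · rintro γ ⟨α, hα, β, hβ, h⟩ γ' ⟨α', hα', β', hβ', h'⟩ he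
    obtain rfl := hV.injOn_left hβ hβ' (h.left_eq.symm.trans (he.trans h'.left_eq))
    obtain ⟨e, rfl⟩ := h
    obtain ⟨e', rfl⟩ := h'
    obtain rfl := hU.injOn_left hα hα' (e.trans e'.symm)
    rfl
  · rintro γ ⟨α, hα, β, hβ, h⟩ γ' ⟨α', hα', β', hβ', h'⟩ he
    obtain rfl := hU.injOn_right hα hα' (h.right_eq.symm.trans (he.trans h'.right_eq))
    obtain ⟨e, rfl⟩ := h
    obtain ⟨e', rfl⟩ := h'
    obtain rfl := hV.injOn_right hβ hβ' (e.symm.trans e')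
    rfl

theorem isCompact_setMul [T2Space X] {K K' : Set (Quiver.Total X)} (hK : IsCompact K)
    (hK' : IsCompact K') : IsCompact (Arr.setMul K K') := by
  let P : Set (Quiver.Total X × Quiver.Total X) := {p | p.1.left = p.2.right}
  have hP : IsClosed P := isClosed_eq (continuous_left.comp continuous_fst)
    (continuous_right.comp continuous_snd)
  have h1 : IsCompact (Subtype.val ⁻¹' (K ×ˢ K') : Set P) :=
    hP.isClosedEmbedding_subtypeVal.isCompact_preimage (hK.prod hK')
  have h2 := h1.image (IsEtaleGroupoid.continuous_comp (X := X))
  convert h2 using 1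
  ext γ
  constructor
  · rintro ⟨α, hα, β, hβ, h, rfl⟩
    exact ⟨⟨(α, β), h⟩, ⟨hα, hβ⟩, rfl⟩
  · rintro ⟨⟨⟨α, β⟩, h⟩, ⟨hα, hβ⟩, rfl⟩
    exact ⟨α, hα, β, hβ, h, rfl⟩

theorem IsCcOn.conv [T2Space X] {U V : Set (Quiver.Total X)} {f g : L.Section}
    (hU : IsBisection U) (hV : IsBisection V) (hf : L.IsCcOn U f) (hg : L.IsCcOn V g) :
    L.IsCcOn (Arr.setMul U V) (L.conv f g) := by
  constructor
  · obtain ⟨-, s, hs, hsU⟩ := hU.exists_section_right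
    obtain ⟨-, t, ht, htV⟩ := hV.exists_section_left
    rw [continuousOn_iff_continuous_domRestrict]
    have hr : ∀ γ : Arr.setMul U V, γ.1.right ∈ Quiver.Total.right '' U := by
      rintro ⟨γ, α, hα, β, hβ, h⟩
      exact ⟨α, hα, h.right_eq.symm⟩
    have hl : ∀ γ : Arr.setMul U V, γ.1.left ∈ Quiver.Total.left '' V := by
      rintro ⟨γ, α, hα, β, hβ, h⟩
      exact ⟨β, hβ, h.left_eq.symm⟩
    let a : Arr.setMul U V → U := fun γ => ⟨s ⟨_, hr γ⟩, (hsU _).1⟩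
    let b : Arr.setMul U V → V := fun γ => ⟨t ⟨_, hl γ⟩, (htV _).1⟩
    have ha : Continuous a := (hs.comp
      ((continuous_right.comp continuous_subtype_val).subtype_mk _)).subtype_mk _
    have hb : Continuous b := (ht.comp
      ((continuous_left.comp continuous_subtype_val).subtype_mk _)).subtype_mk _
    have hab : ∀ γ, Arr.IsComp (a γ).1 (b γ).1 γ.1 := by
      rintro ⟨γ, α, hα, β, hβ, h⟩
      have h1 : (a ⟨γ, α, hα, β, hβ, h⟩).1 = α :=
        hU.injOn_right (hsU _).1 hα ((hsU _).2.trans h.right_eq)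
      have h2 : (b ⟨γ, α, hα, β, hβ, h⟩).1 = β :=
        hV.injOn_left (htV _).1 hβ ((htV _).2.trans h.left_eq)
      rw [h1, h2]
      exact h
    have hfa := (continuousOn_iff_continuous_domRestrict.1 hf.continuousOn).comp ha
    have hgb := (continuousOn_iff_continuous_domRestrict.1 hg.continuousOn).comp hb
    have hF : Continuous fun γ : Arr.setMul U V =>
        (⟨(⟨(a γ).1, f (a γ).1⟩, ⟨(b γ).1, g (b γ).1⟩), (hab γ).1⟩ :
          {z : TotalSpace 𝕜 L.fiber × TotalSpace 𝕜 L.fiber //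
            z.1.proj.left = z.2.proj.right}) :=
      (hfa.prodMk hgb).subtype_mk _
    refine (L.continuous_mul.comp hF).congr fun γ => ?_
    dsimp only [Function.comp_apply, Set.domRestrict_apply]
    rw [hf.conv_apply hU (a γ).2 (hab γ)]
    exact L.mk_mul_eq _ _ _ _
  · obtain ⟨K, hKU, hK, hK0⟩ := hf.compact
    obtain ⟨K', hKV, hK', hK0'⟩ := hg.compact
    refine ⟨Arr.setMul K K', ?_, isCompact_setMul hK hK', ?_⟩
    · rintro γ ⟨α, hα, β, hβ, h⟩
      exact ⟨α, hKU hα, β, hKV hβ, h⟩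
    · intro γ hγ
      refine conv_eq_zero fun α β h h0 => ?_
      by_contra h0'
      refine hγ ⟨α, ?_, β, ?_, h⟩
      · by_contra hα
        exact h0 (hK0 α hα)
      · by_contra hβ
        exact h0' (hK0' β hβ)

theorem conv_mem [T2Space X] {f g : L.Section} (hf : f ∈ L.Cc) (hg : g ∈ L.Cc) :
    L.conv f g ∈ L.Cc := by
  induction hf using Submodule.span_induction with
  | zero => rw [conv_zero_left]; exact zero_mem _
  | add f f' h1 h2 h h' => rw [conv_add_left h1 h2]; exact add_mem h h'
  | smul c f _ h => rw [conv_smul_left]; exact Submodule.smul_mem _ _ h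
  | mem f hf =>
    have hf' : f ∈ L.Cc := Submodule.subset_span hf
    obtain ⟨U, hU, hfU⟩ := hf
    induction hg using Submodule.span_induction with
    | zero => rw [conv_zero_right]; exact zero_mem _
    | add g g' h1 h2 h h' => rw [conv_add_right hf']; exact add_mem h h'
    | smul c g _ h => rw [conv_smul_right]; exact Submodule.smul_mem _ _ h
    | mem g hg =>
      obtain ⟨V, hV, hgV⟩ := hg
      exact Submodule.subset_span ⟨_, isBisection_setMul hU hV, hfU.conv hU hV hgV⟩

theorem IsCcOn.conv_assoc [T2Space X] {U V : Set (Quiver.Total X)} {f g : L.Section}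
    (hU : IsBisection U) (hV : IsBisection V) (hf : L.IsCcOn U f) (hg : L.IsCcOn V g)
    (h : L.Section) : L.conv (L.conv f g) h = L.conv f (L.conv g h) := by
  funext ε
  by_cases hε : ∃ α ∈ U, ∃ β ∈ V, ∃ γ δ, Arr.IsComp α β δ ∧ Arr.IsComp δ γ ε
  · obtain ⟨α, hα, β, hβ, γ, δ, h1, h2⟩ := hε
    obtain ⟨ζ, h3, h4⟩ := Arr.isComp_assoc h1 h2
    rw [(hf.conv hU hV hg).conv_apply (isBisection_setMul hU hV) ⟨α, hα, β, hβ, h1⟩ h2,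
      hf.conv_apply hU hα h1, hf.conv_apply hU hα h4, hg.conv_apply hV hβ h3]
    exact L.mul_assoc _ _ _ _ _ _ _
  · rw [conv_eq_zero, conv_eq_zero]
    · intro α ζ h1 h0
      refine conv_eq_zero fun β γ h2 h0' => ?_
      obtain ⟨δ, h3, h4⟩ := Arr.isComp_assoc' h2 h1
      exact absurd ⟨α, hf.mem_of_ne h0, β, hg.mem_of_ne h0', γ, δ, h3, h4⟩ hε
    · intro δ γ h1 h0
      obtain ⟨α, hα, β, hβ, h2⟩ := (hf.conv hU hV hg).mem_of_ne h0
      exact absurd ⟨α, hα, β, hβ, γ, δ, h2, h1⟩ hε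

theorem conv_assoc [T2Space X] {f g : L.Section} (hf : f ∈ L.Cc) (hg : g ∈ L.Cc)
    (k : L.Section) : L.conv (L.conv f g) k = L.conv f (L.conv g k) := by
  induction hf using Submodule.span_induction with
  | zero => simp only [conv_zero_left]
  | add f f' h1 h2 h h' =>
    rw [conv_add_left h1 h2, conv_add_left (conv_mem h1 hg) (conv_mem h2 hg), h, h',
      conv_add_left h1 h2]
  | smul c f _ h => rw [conv_smul_left, conv_smul_left, h, conv_smul_left]
  | mem f hf =>
    have hf' : f ∈ L.Cc := Submodule.subset_span hf
    obtain ⟨U, hU, hfU⟩ := hf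
    induction hg using Submodule.span_induction with
    | zero => simp only [conv_zero_left, conv_zero_right]
    | add g g' h1 h2 h h' =>
      rw [conv_add_right hf', conv_add_left (conv_mem hf' h1) (conv_mem hf' h2), h, h',
        conv_add_left h1 h2, conv_add_right hf']
    | smul c g _ h =>
      rw [conv_smul_right, conv_smul_left, h, conv_smul_left, conv_smul_right]
    | mem g hg =>
      obtain ⟨V, hV, hgV⟩ := hg
      exact hfU.conv_assoc hU hV hgV k

end Etale

/-! ### The norm `‖·‖_max` -/

theorem IsCcOn.iSup_conv_le {U V : Set (Quiver.Total X)} {f g : L.Section}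
    (hU : IsBisection U) (hf : L.IsCcOn U f) (hg : L.IsCcOn V g) :
    ⨆ γ, ‖L.conv f g γ‖ ≤ (⨆ γ, ‖f γ‖) * ⨆ γ, ‖g γ‖ := by
  have h0 : 0 ≤ (⨆ γ, ‖f γ‖) * ⨆ γ, ‖g γ‖ :=
    mul_nonneg (Real.iSup_nonneg fun _ => norm_nonneg _) (Real.iSup_nonneg fun _ => norm_nonneg _)
  refine Real.iSup_le (fun γ => ?_) h0
  by_cases h : ∃ α ∈ U, ∃ β, Arr.IsComp α β γ
  · obtain ⟨α, hα, β, h⟩ := h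
    rw [hf.conv_apply hU hα h, L.norm_mul]
    exact mul_le_mul (le_ciSup hf.bddAbove α) (le_ciSup hg.bddAbove β) (norm_nonneg _)
      (Real.iSup_nonneg fun _ => norm_nonneg _)
  · rw [conv_eq_zero fun α β h' h0 => absurd ⟨α, hf.mem_of_ne h0, β, h'⟩ h, norm_zero]
    exact h0

theorem maxNorm_bddBelow (f : L.Section) :
    BddBelow {s | ∃ (n : ℕ) (U : Fin n → Set (Quiver.Total X)) (g : Fin n → L.Section),
    (∀ k, IsBisection (U k) ∧ L.IsCcOn (U k) (g k)) ∧ f = ∑ k, g k ∧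
      s = ∑ k, ⨆ γ, ‖g k γ‖} := by
  refine ⟨0, ?_⟩
  rintro s ⟨n, U, g, -, -, rfl⟩
  exact Finset.sum_nonneg fun k _ => Real.iSup_nonneg fun _ => norm_nonneg _

theorem maxNorm_nonneg (f : L.Section) : 0 ≤ L.maxNorm f := by
  refine Real.sInf_nonneg ?_
  rintro s ⟨n, U, g, -, -, rfl⟩
  exact Finset.sum_nonneg fun k _ => Real.iSup_nonneg fun _ => norm_nonneg _

theorem maxNorm_le {ι : Type*} [Fintype ι] {f : L.Section} (U : ι → Set (Quiver.Total X))
    (g : ι → L.Section) (h : ∀ k, IsBisection (U k) ∧ L.IsCcOn (U k) (g k))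
    (hf : f = ∑ k, g k) : L.maxNorm f ≤ ∑ k, ⨆ γ, ‖g k γ‖ := by
  let e := (Fintype.equivFin ι).symm
  refine csInf_le (maxNorm_bddBelow f) ⟨Fintype.card ι, U ∘ e, g ∘ e, fun k => h _, ?_, ?_⟩
  · rw [hf]
    exact (Equiv.sum_comp e g).symm
  · exact (Equiv.sum_comp e fun k => ⨆ γ, ‖g k γ‖).symm

theorem exists_sum {f : L.Section} (hf : f ∈ L.Cc) :
    ∃ (n : ℕ) (U : Fin n → Set (Quiver.Total X)) (g : Fin n → L.Section),
    (∀ k, IsBisection (U k) ∧ L.IsCcOn (U k) (g k)) ∧ f = ∑ k, g k := by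
  induction hf using Submodule.span_induction with
  | mem f hf =>
    obtain ⟨U, hU, hfU⟩ := hf
    exact ⟨1, fun _ => U, fun _ => f, fun _ => ⟨hU, hfU⟩, by simp⟩
  | zero => exact ⟨0, Fin.elim0, Fin.elim0, fun k => k.elim0, by simp⟩
  | add f f' _ _ h h' =>
    obtain ⟨n, U, g, hg, rfl⟩ := h
    obtain ⟨m, V, g', hg', rfl⟩ := h'
    refine ⟨n + m, Fin.append U V, Fin.append g g', fun k => ?_, by simp [Fin.sum_univ_add]⟩
    refine Fin.addCases (fun i => ?_) (fun i => ?_) k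
    · simpa using hg i
    · simpa using hg' i
  | smul c f _ h =>
    obtain ⟨n, U, g, hg, rfl⟩ := h
    exact ⟨n, U, fun k => c • g k, fun k => ⟨(hg k).1, (hg k).2.smul c⟩, Finset.smul_sum⟩

theorem exists_lt_of_maxNorm_lt {f : L.Section} (hf : f ∈ L.Cc) {t : ℝ} (ht : L.maxNorm f < t) :
    ∃ (n : ℕ) (U : Fin n → Set (Quiver.Total X)) (g : Fin n → L.Section),
    (∀ k, IsBisection (U k) ∧ L.IsCcOn (U k) (g k)) ∧ f = ∑ k, g k ∧
      ∑ k, ⨆ γ, ‖g k γ‖ < t := by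
  obtain ⟨n, U, g, hg, hs⟩ := exists_sum hf
  have hne : {s | ∃ (n : ℕ) (U : Fin n → Set (Quiver.Total X)) (g : Fin n → L.Section),
    (∀ k, IsBisection (U k) ∧ L.IsCcOn (U k) (g k)) ∧ f = ∑ k, g k ∧
      s = ∑ k, ⨆ γ, ‖g k γ‖}.Nonempty := ⟨_, n, U, g, hg, hs, rfl⟩
  obtain ⟨s, ⟨n, U, g, hg, hs, rfl⟩, hlt⟩ := exists_lt_of_csInf_lt hne ht
  exact ⟨n, U, g, hg, hs, hlt⟩

theorem maxNorm_zero : L.maxNorm (0 : L.Section) = 0 := by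
  refine le_antisymm ?_ (maxNorm_nonneg _)
  simpa using maxNorm_le (L := L) (f := 0) (ι := Fin 0) Fin.elim0 Fin.elim0 (fun k => k.elim0)
    (by simp)

theorem maxNorm_add_le {f g : L.Section} (hf : f ∈ L.Cc) (hg : g ∈ L.Cc) :
    L.maxNorm (f + g) ≤ L.maxNorm f + L.maxNorm g := by
  refine le_of_forall_pos_lt_add fun ε hε => ?_
  obtain ⟨n, U, a, ha, rfl, ha'⟩ :=
    exists_lt_of_maxNorm_lt hf (show L.maxNorm f < L.maxNorm f + ε / 2 by linarith)
  obtain ⟨m, V, b, hb, rfl, hb'⟩ :=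
    exists_lt_of_maxNorm_lt hg (show L.maxNorm g < L.maxNorm g + ε / 2 by linarith)
  have := maxNorm_le (L := L) (f := ∑ k, a k + ∑ k, b k) (Sum.elim U V) (Sum.elim a b)
    (by rintro (k | k); exacts [ha k, hb k]) (by simp)
  simp only [Fintype.sum_sum_type, Sum.elim_inl, Sum.elim_inr] at this
  linarith

theorem maxNorm_smul_le {f : L.Section} (hf : f ∈ L.Cc) (c : 𝕜) :
    L.maxNorm (c • f) ≤ ‖c‖ * L.maxNorm f := by
  refine le_of_forall_pos_lt_add fun ε hε => ?_
  have hc : 0 < ‖c‖ + 1 := by positivity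
  obtain ⟨n, U, a, ha, rfl, ha'⟩ := exists_lt_of_maxNorm_lt hf
    (show L.maxNorm f < L.maxNorm f + ε / (‖c‖ + 1) by have := div_pos hε hc; linarith)
  refine (maxNorm_le U (fun k => c • a k) (fun k => ⟨(ha k).1, (ha k).2.smul c⟩)
    Finset.smul_sum).trans_lt ?_
  have h1 : ∀ k, ⨆ γ, ‖(c • a k) γ‖ = ‖c‖ * ⨆ γ, ‖a k γ‖ := fun k => by
    rw [Real.mul_iSup_of_nonneg (norm_nonneg c)]
    simp [norm_smul]
  simp only [h1, ← Finset.mul_sum]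
  have h2 : ‖c‖ * (ε / (‖c‖ + 1)) < ε := by
    rw [← mul_div_assoc, div_lt_iff₀ hc]
    nlinarith
  have h3 := mul_le_mul_of_nonneg_left ha'.le (norm_nonneg c)
  rw [mul_add] at h3
  linarith

theorem maxNorm_neg {f : L.Section} (hf : f ∈ L.Cc) : L.maxNorm (-f) = L.maxNorm f := by
  have h : ∀ {g : L.Section}, g ∈ L.Cc → L.maxNorm (-g) ≤ L.maxNorm g := fun {g} hg => by
    simpa using maxNorm_smul_le hg (-1 : 𝕜)
  exact le_antisymm (h hf) (by simpa using h (neg_mem hf))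

theorem maxNorm_conv_le [IsEtaleGroupoid X] [T2Space X] {f g : L.Section} (hf : f ∈ L.Cc)
    (hg : g ∈ L.Cc) : L.maxNorm (L.conv f g) ≤ L.maxNorm f * L.maxNorm g := by
  have key : ∀ s > L.maxNorm f, ∀ t > L.maxNorm g, L.maxNorm (L.conv f g) ≤ s * t := by
    intro s hs t ht
    obtain ⟨n, U, a, ha, hfa, ha'⟩ := exists_lt_of_maxNorm_lt hf hs
    obtain ⟨m, V, b, hb, hgb, hb'⟩ := exists_lt_of_maxNorm_lt hg ht
    have hmem : ∀ k, a k ∈ L.Cc := fun k => Submodule.subset_span (Exists.intro (U k) (ha k))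
    have hsum : L.conv f g = ∑ p : Fin n × Fin m, L.conv (a p.1) (b p.2) := by
      have h1 : ∀ T : Finset (Fin n), L.conv (∑ k ∈ T, a k) g = ∑ k ∈ T, L.conv (a k) g := by
        intro T
        induction T using Finset.induction_on with
        | empty => simp [conv_zero_left]
        | insert i T hi ih =>
          rw [Finset.sum_insert hi, Finset.sum_insert hi,
            conv_add_left (hmem i) (sum_mem fun k _ => hmem k), ih]
      have h2 : ∀ (k : Fin n) (T : Finset (Fin m)),
          L.conv (a k) (∑ j ∈ T, b j) = ∑ j ∈ T, L.conv (a k) (b j) := by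
        intro k T
        induction T using Finset.induction_on with
        | empty => simp [conv_zero_right]
        | insert i T hi ih =>
          rw [Finset.sum_insert hi, Finset.sum_insert hi, conv_add_right (hmem k), ih]
      rw [Fintype.sum_prod_type]
      conv_lhs => rw [hfa, h1]
      refine Finset.sum_congr rfl fun k _ => ?_
      rw [hgb, h2]
    refine (maxNorm_le (fun p : Fin n × Fin m => Arr.setMul (U p.1) (V p.2)) _ (fun p =>
      ⟨isBisection_setMul (ha p.1).1 (hb p.2).1,
        (ha p.1).2.conv (ha p.1).1 (hb p.2).1 (hb p.2).2⟩) hsum).trans ?_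
    calc ∑ p : Fin n × Fin m, ⨆ γ, ‖L.conv (a p.1) (b p.2) γ‖
        ≤ ∑ p : Fin n × Fin m, (⨆ γ, ‖a p.1 γ‖) * ⨆ γ, ‖b p.2 γ‖ :=
          Finset.sum_le_sum fun p _ => (ha p.1).2.iSup_conv_le (ha p.1).1 (hb p.2).2
      _ = (∑ k, ⨆ γ, ‖a k γ‖) * ∑ k, ⨆ γ, ‖b k γ‖ := by
          rw [Fintype.sum_prod_type, Finset.sum_mul_sum]
      _ ≤ s * t := by
          refine mul_le_mul ha'.le hb'.le ?_ ((maxNorm_nonneg f).trans hs.le)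
          exact Finset.sum_nonneg fun k _ => Real.iSup_nonneg fun _ => norm_nonneg _
  have h1 : ∀ s > L.maxNorm f, L.maxNorm (L.conv f g) ≤ s * L.maxNorm g := by
    intro s hs
    have hs0 : 0 < s := (maxNorm_nonneg f).trans_lt hs
    rw [← div_le_iff₀' hs0]
    refine le_of_forall_gt_imp_ge_of_dense fun t ht => ?_
    rw [div_le_iff₀' hs0]
    exact key s hs t ht
  have hcont : Continuous fun s : ℝ => s * L.maxNorm g := by fun_prop
  refine ge_of_tendsto (hcont.continuousWithinAt (s := Set.Ioi (L.maxNorm f)) (x := L.maxNorm f))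
    ?_
  filter_upwards [self_mem_nhdsWithin] with s hs using h1 s hs

end Algebra
end Twist

/-! ## Completion of a non-unital normed algebra -/

namespace NonUnitalCompletion

open UniformSpace

variable {A : Type*} [NonUnitalSeminormedRing A]

noncomputable instance mul : Mul (Completion A) :=
  ⟨Function.curry <| (Completion.isDenseInducing_coe.prodMap Completion.isDenseInducing_coe).extend
    ((↑) ∘ Function.uncurry (· * ·))⟩

theorem coe_mul (a b : A) : ((a * b : A) : Completion A) = a * b :=
  ((Completion.isDenseInducing_coe.prodMap Completion.isDenseInducing_coe).extend_eq
    ((Completion.continuous_coe A).comp (continuous_mul (M := A))) (a, b)).symm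

instance : ContinuousMul (Completion A) where
  continuous_mul := by
    let m := (AddMonoidHom.mul : A →+ A →+ A).compr₂ Completion.toCompl
    have : Continuous fun p : A × A => m p.1 p.2 :=
      (Completion.continuous_coe A).comp (continuous_mul (M := A))
    have di : IsDenseInducing (Completion.toCompl : A → Completion A) :=
      Completion.isDenseInducing_coe
    exact di.extend_Z_bilin di this

noncomputable instance nonUnitalNormedRing : NonUnitalNormedRing (Completion A) where
  __ : NormedAddCommGroup (Completion A) := inferInstance
  __ : Mul (Completion A) := inferInstance
  zero_mul a := Completion.induction_on a (isClosed_eq (by fun_prop) continuous_const)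
    fun a => by rw [← Completion.coe_zero, ← coe_mul, zero_mul]
  mul_zero a := Completion.induction_on a (isClosed_eq (by fun_prop) continuous_const)
    fun a => by rw [← Completion.coe_zero, ← coe_mul, mul_zero]
  mul_assoc a b c := Completion.induction_on₃ a b c (isClosed_eq (by fun_prop) (by fun_prop))
    fun a b c => by rw [← coe_mul, ← coe_mul, ← coe_mul, ← coe_mul, mul_assoc]
  left_distrib a b c := Completion.induction_on₃ a b c (isClosed_eq (by fun_prop) (by fun_prop))
    fun a b c => by
      rw [← Completion.coe_add, ← coe_mul, ← coe_mul, ← coe_mul, ← Completion.coe_add, mul_add]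
  right_distrib a b c := Completion.induction_on₃ a b c (isClosed_eq (by fun_prop) (by fun_prop))
    fun a b c => by
      rw [← Completion.coe_add, ← coe_mul, ← coe_mul, ← coe_mul, ← Completion.coe_add, add_mul]
  norm_mul_le a b := Completion.induction_on₂ a b (isClosed_le (by fun_prop) (by fun_prop))
    fun a b => by
      rw [← coe_mul, Completion.norm_coe, Completion.norm_coe, Completion.norm_coe]
      exact norm_mul_le a b

end NonUnitalCompletion

/-! ## The algebra `F(G, L)` and the regular representation -/

namespace Twist

section

variable {𝕜 : Type} [RCLike 𝕜] {X : Type u} [TopologicalSpace X] [Groupoid.{v} X]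
  [TopologicalSpace (Quiver.Total X)]

/-- The convolution algebra `𝔠_c(G, L)`, normed by `‖·‖_max`. -/
def CcAlg (L : Twist.{u, v, w} 𝕜 X) : Type (max u v w) := L.Cc

instance (L : Twist.{u, v, w} 𝕜 X) : AddCommGroup L.CcAlg := inferInstanceAs (AddCommGroup L.Cc)

noncomputable instance (L : Twist.{u, v, w} 𝕜 X) : Module 𝕜 L.CcAlg :=
  inferInstanceAs (Module 𝕜 L.Cc)

/-- The section underlying an element of the convolution algebra. -/
def CcAlg.val {L : Twist.{u, v, w} 𝕜 X} (f : L.CcAlg) : L.Section := Subtype.val f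

theorem CcAlg.mem {L : Twist.{u, v, w} 𝕜 X} (f : L.CcAlg) : f.val ∈ L.Cc := Subtype.property f

theorem CcAlg.ext {L : Twist.{u, v, w} 𝕜 X} {f g : L.CcAlg} (h : f.val = g.val) : f = g :=
  Subtype.ext h

/-- The element of the convolution algebra given by a section in `L.Cc`. -/
def CcAlg.mk {L : Twist.{u, v, w} 𝕜 X} (f : L.Section) (hf : f ∈ L.Cc) : L.CcAlg := ⟨f, hf⟩

variable (L : Twist.{u, v, w} 𝕜 X) [IsEtaleGroupoid X] [T2Space X]

noncomputable instance : NonUnitalRing L.CcAlg where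
  __ : AddCommGroup L.CcAlg := inferInstance
  mul f g := CcAlg.mk (L.conv f.val g.val) (conv_mem f.mem g.mem)
  left_distrib f g h := CcAlg.ext (conv_add_right f.mem g.val h.val)
  right_distrib f g h := CcAlg.ext (conv_add_left f.mem g.mem h.val)
  zero_mul f := CcAlg.ext (conv_zero_left f.val)
  mul_zero f := CcAlg.ext (conv_zero_right f.val)
  mul_assoc f g h := CcAlg.ext (conv_assoc f.mem g.mem h.val)

theorem CcAlg.val_mul (f g : L.CcAlg) : (f * g).val = L.conv f.val g.val := rfl

noncomputable instance : NonUnitalSeminormedRing L.CcAlg where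
  __ := AddGroupSeminorm.toSeminormedAddCommGroup (E := L.CcAlg)
    { toFun := fun f => L.maxNorm f.val
      map_zero' := maxNorm_zero
      add_le' := fun f g => maxNorm_add_le f.mem g.mem
      neg' := fun f => maxNorm_neg f.mem }
  __ : NonUnitalRing L.CcAlg := inferInstance
  norm_mul_le f g := maxNorm_conv_le f.mem g.mem

theorem CcAlg.norm_def (f : L.CcAlg) : ‖f‖ = L.maxNorm f.val := rfl

noncomputable instance : NormedSpace 𝕜 L.CcAlg where
  norm_smul_le c f := maxNorm_smul_le f.mem c

/-- The groupoid Banach algebra `F(G, L)`, the completion of the convolution algebra in the norm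
`‖·‖_max`. -/
abbrev BanachAlg : Type (max u v w) := UniformSpace.Completion L.CcAlg

/-- The inclusion of the convolution algebra into its completion. -/
noncomputable def toBanachAlg : L.CcAlg →ₙₐ[𝕜] L.BanachAlg where
  toFun f := (f : UniformSpace.Completion L.CcAlg)
  map_smul' c f := UniformSpace.Completion.coe_smul c f
  map_zero' := UniformSpace.Completion.coe_zero
  map_add' f g := UniformSpace.Completion.coe_add f g
  map_mul' f g := NonUnitalCompletion.coe_mul f g

/-- The Banach space `ℓ^p(G, L)` of `p`-summable (for `p = ∞`, bounded) sections. -/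
abbrev ellP (p : ℝ≥0∞) : Type (max u v w) := lp L.fiber p

variable {L}

/-- `Λ` is the left regular representation of `F(G, L)` on `ℓ^p(G, L)`: a contractive
homomorphism such that `Λ(f)ξ = f * ξ` for `f ∈ 𝔠_c(G, L)`. -/
structure IsRegularRep {p : ℝ≥0∞} [Fact (1 ≤ p)]
    (Λ : L.BanachAlg →ₙₐ[𝕜] (L.ellP p →L[𝕜] L.ellP p)) : Prop where
  norm_le : ∀ a, ‖Λ a‖ ≤ ‖a‖
  apply_eq : ∀ (f : L.CcAlg) (ξ : L.ellP p),
    (Λ (L.toBanachAlg f) ξ : ∀ γ, L.fiber γ) = L.conv f.val ξ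

/-- The closure of the image of `𝔠_c(G, L)` under a representation of `F(G, L)`; for the regular
representation on `ℓ^p(G, L)` this is `F^p_red(G, L)`. -/
noncomputable def closedImage {E : Type*} [NormedAddCommGroup E] [NormedSpace 𝕜 E]
    (Λ : L.BanachAlg →ₙₐ[𝕜] (E →L[𝕜] E)) : NonUnitalSubalgebra 𝕜 (E →L[𝕜] E) :=
  (NonUnitalAlgHom.range (Λ.comp L.toBanachAlg)).topologicalClosure

/-- The operator `Λ(f)`, for `f ∈ 𝔠_c(G, L)`, as an element of `closedImage Λ`. -/
noncomputable def toClosedImage {E : Type*} [NormedAddCommGroup E] [NormedSpace 𝕜 E]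
    (Λ : L.BanachAlg →ₙₐ[𝕜] (E →L[𝕜] E)) (f : L.CcAlg) : closedImage Λ :=
  ⟨Λ (L.toBanachAlg f), NonUnitalSubalgebra.le_topologicalClosure _ ⟨f, rfl⟩⟩

end

/-! ## Opposite and trivial twists -/

section Op

variable {𝕜 : Type} [RCLike 𝕜] {X : Type u} [TopologicalSpace X] [Groupoid.{v} X]
  [TopologicalSpace (Quiver.Total X)]

/-- The map `(γ, z) ↦ (γ⁻¹, z)` from the bundle with fibers `L_{γ⁻¹}` to `L`. -/
def flip (L : Twist.{u, v, w} 𝕜 X) (z : TotalSpace 𝕜 fun γ => L.fiber (Arr.inv γ)) :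
    TotalSpace 𝕜 L.fiber := ⟨Arr.inv z.proj, z.snd⟩

theorem flip_bijective (L : Twist.{u, v, w} 𝕜 X) : Function.Bijective L.flip := by
  constructor
  · rintro ⟨γ, z⟩ ⟨γ', z'⟩ h
    have h1 : Arr.inv γ = Arr.inv γ' := congrArg TotalSpace.proj h
    obtain rfl := Arr.inv_injective h1
    have h2 : (⟨Arr.inv γ, z⟩ : TotalSpace 𝕜 L.fiber) = ⟨Arr.inv γ, z'⟩ := h
    simp only [TotalSpace.mk.injEq, heq_eq_eq, true_and] at h2
    rw [h2]
  · rintro ⟨γ, z⟩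
    obtain ⟨γ, rfl⟩ : ∃ γ', γ = Arr.inv γ' := ⟨Arr.inv γ, (Arr.inv_inv γ).symm⟩
    exact ⟨⟨γ, z⟩, rfl⟩

variable [IsEtaleGroupoid X]

/-- The opposite twist: the fiber over `γ` is `L_{γ⁻¹}`, the total space is topologized so that
it is homeomorphic to the total space of `L` in the obvious way, the product of `z` and `w` is
`w · z`, and the involution is that of `L`. -/
def op (L : Twist.{u, v, w} 𝕜 X) : Twist.{u, v, w} 𝕜 X :=
  letI top : TopologicalSpace (TotalSpace 𝕜 fun γ => L.fiber (Arr.inv γ)) :=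
    TopologicalSpace.induced L.flip inferInstance
  have hfl : IsInducing L.flip := ⟨rfl⟩
  { fiber := fun γ => L.fiber (Arr.inv γ)
    normedAddCommGroup := fun γ => L.normedAddCommGroup (Arr.inv γ)
    normedSpace := fun γ => L.normedSpace (Arr.inv γ)
    finrank_fiber := fun γ => L.finrank_fiber (Arr.inv γ)
    topology := top
    continuous_proj := by
      refine ((IsEtaleGroupoid.continuous_inv.comp L.continuous_proj).comp hfl.continuous).congr ?_
      exact fun z => Arr.inv_inv _
    isOpenMap_proj := by
      intro U hU
      obtain ⟨V, hV, rfl⟩ := isOpen_induced_iff.1 hU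
      have : TotalSpace.proj '' (L.flip ⁻¹' V) = Arr.inv ⁻¹' (TotalSpace.proj '' V) := by
        ext γ
        constructor
        · rintro ⟨z, hz, rfl⟩
          exact ⟨L.flip z, hz, rfl⟩
        · rintro ⟨z, hz, h⟩
          obtain ⟨z, rfl⟩ := L.flip_bijective.2 z
          exact ⟨z, hz, Arr.inv_injective h⟩
      rw [this]
      exact (L.isOpenMap_proj V hV).preimage IsEtaleGroupoid.continuous_inv
    continuous_add := by
      rw [hfl.continuous_iff]
      let ψ : TotalSpace (𝕜 × 𝕜) ((fun γ => L.fiber (Arr.inv γ)) ×ᵇ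
          fun γ => L.fiber (Arr.inv γ)) → TotalSpace (𝕜 × 𝕜) (L.fiber ×ᵇ L.fiber) :=
        fun z => ⟨Arr.inv z.proj, z.snd⟩
      have hψ : Continuous ψ := by
        rw [(FiberBundle.Prod.isInducing_diag 𝕜 L.fiber 𝕜 L.fiber).continuous_iff]
        have h1 := (FiberBundle.Prod.isInducing_diag 𝕜 (fun γ => L.fiber (Arr.inv γ)) 𝕜
          (fun γ => L.fiber (Arr.inv γ))).continuous
        exact (hfl.continuous.prodMap hfl.continuous).comp h1
      exact L.continuous_add.comp hψ
    continuous_smul := by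
      rw [hfl.continuous_iff]
      exact L.continuous_smul.comp (continuous_id.prodMap hfl.continuous)
    continuous_norm := L.continuous_norm.comp hfl.continuous
    mul := fun h => (L.mul h.inv).flip
    continuous_mul := by
      rw [hfl.continuous_iff]
      let ψ : {z : TotalSpace 𝕜 (fun γ => L.fiber (Arr.inv γ)) ×
          TotalSpace 𝕜 (fun γ => L.fiber (Arr.inv γ)) // z.1.proj.left = z.2.proj.right} →
          {z : TotalSpace 𝕜 L.fiber × TotalSpace 𝕜 L.fiber // z.1.proj.left = z.2.proj.right} :=
        fun z => ⟨(L.flip z.1.2, L.flip z.1.1), z.2.symm⟩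
      have hψ : Continuous ψ := by
        refine Continuous.subtype_mk (Continuous.prodMk ?_ ?_) _
        · exact hfl.continuous.comp (continuous_snd.comp continuous_subtype_val)
        · exact hfl.continuous.comp (continuous_fst.comp continuous_subtype_val)
      refine (L.continuous_mul.comp hψ).congr fun z => ?_
      exact L.mk_mul_eq _ _ _ _
    mul_assoc := fun h₁ h₂ h₃ h₄ a b c =>
      (L.mul_assoc h₃.inv h₄.inv h₁.inv h₂.inv c b a).symm
    norm_mul := fun h a b => (L.norm_mul h.inv b a).trans (mul_comm _ _)
    star := fun γ => L.star (Arr.inv γ)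
    continuous_star := by
      rw [hfl.continuous_iff]
      exact L.continuous_star.comp hfl.continuous
    star_star := fun γ z => L.flip_bijective.1 (L.star_star (Arr.inv γ) z)
    norm_star := fun γ z => L.norm_star (Arr.inv γ) z
    star_mul := fun h a b => L.star_mul h.inv b a
    mul_star_self := by
      intro γ ε δ h h' z b
      have hinj : Function.Injective (L.star (Arr.inv δ)) :=
        (injective_iff_map_eq_zero _).2 fun a ha => by
          rw [← norm_eq_zero, ← L.norm_star, ha, norm_zero]
      apply hinj
      change L.star _ (L.mul h'.inv b (L.mul h.inv (L.star _ z) z)) = L.star _ (_ • b)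
      rw [L.star_mul, L.star_mul, L.mul_star_self, L.norm_star, LinearMap.map_smulₛₗ]
      simp }

/-- The map `f ↦ f̌`, `f̌(γ) = f(γ⁻¹)`, from sections of `L` to sections of the opposite twist. -/
def check (L : Twist.{u, v, w} 𝕜 X) (f : L.Section) : L.op.Section := fun γ => f (Arr.inv γ)

theorem check_mem (L : Twist.{u, v, w} 𝕜 X) {f : L.Section} (hf : f ∈ L.Cc) :
    L.check f ∈ L.op.Cc := by
  induction hf using Submodule.span_induction with
  | zero => exact zero_mem L.op.Cc
  | add f g _ _ hf hg => exact add_mem hf hg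
  | smul c f _ hf => exact Submodule.smul_mem L.op.Cc c hf
  | mem f hf =>
    obtain ⟨U, hU, hfU⟩ := hf
    refine Submodule.subset_span ⟨Arr.inv ⁻¹' U, ?_, ?_, ?_⟩
    · refine IsBisection.of_injOn (hU.isOpen.preimage IsEtaleGroupoid.continuous_inv) ?_ ?_
      · intro γ hγ γ' hγ' h
        exact Arr.inv_injective (hU.injOn_right hγ hγ' h)
      · intro γ hγ γ' hγ' h
        exact Arr.inv_injective (hU.injOn_left hγ hγ' h)
    · have hfl : IsInducing L.flip (tX := L.op.topology) := ⟨rfl⟩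
      refine (hfl.continuousOn_iff (f := fun γ => (⟨γ, L.check f γ⟩ :
        TotalSpace 𝕜 L.op.fiber))).2 ?_
      exact hfU.continuousOn.comp IsEtaleGroupoid.continuous_inv.continuousOn fun _ h => h
    · obtain ⟨K, hKU, hK, h0⟩ := hfU.compact
      refine ⟨Arr.inv '' K, ?_, hK.image IsEtaleGroupoid.continuous_inv, fun γ hγ => h0 _ ?_⟩
      · rintro _ ⟨γ, hγ, rfl⟩
        change Arr.inv (Arr.inv γ) ∈ U
        rw [Arr.inv_inv]
        exact hKU hγ
      · exact fun h => hγ ⟨_, h, Arr.inv_inv γ⟩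

/-- The map `f ↦ f̌` on the convolution algebra. -/
def CcAlg.check {L : Twist.{u, v, w} 𝕜 X} (f : L.CcAlg) : L.op.CcAlg :=
  CcAlg.mk (L.check f.val) (L.check_mem f.mem)

end Op

section Trivial

theorem trivial_inducing (𝕜 : Type) [RCLike 𝕜] (X : Type u) [Groupoid.{v} X]
    [TopologicalSpace (Quiver.Total X)] :
    IsInducing fun z : TotalSpace 𝕜 (Bundle.Trivial (Quiver.Total X) 𝕜) =>
    ((z.proj, z.snd) : Quiver.Total X × 𝕜) :=
  Bundle.Trivial.isInducing_toProd (Quiver.Total X) 𝕜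

variable (𝕜 : Type) [RCLike 𝕜] (X : Type u) [TopologicalSpace X] [Groupoid.{v} X]
  [TopologicalSpace (Quiver.Total X)] [IsEtaleGroupoid X]

/-- The trivial twist `G × 𝕜` with pointwise operations. -/
def trivial : Twist.{u, v, 0} 𝕜 X where
  fiber := Bundle.Trivial (Quiver.Total X) 𝕜
  normedAddCommGroup := fun _ => inferInstanceAs (NormedAddCommGroup 𝕜)
  normedSpace := fun _ => inferInstanceAs (NormedSpace 𝕜 𝕜)
  finrank_fiber := fun _ => Module.finrank_self 𝕜
  topology := inferInstance
  continuous_proj := continuous_fst.comp (trivial_inducing 𝕜 X).continuous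
  isOpenMap_proj :=
    isOpenMap_fst.comp (Bundle.Trivial.homeomorphProd (Quiver.Total X) 𝕜).isOpenMap
  continuous_add := by
    rw [(trivial_inducing 𝕜 X).continuous_iff]
    have h := (FiberBundle.Prod.isInducing_diag 𝕜 (Bundle.Trivial (Quiver.Total X) 𝕜) 𝕜
      (Bundle.Trivial (Quiver.Total X) 𝕜)).continuous
    have h1 := (trivial_inducing 𝕜 X).continuous.comp (continuous_fst.comp h)
    have h2 := (trivial_inducing 𝕜 X).continuous.comp (continuous_snd.comp h)
    have h3 : Continuous fun z : TotalSpace (𝕜 × 𝕜) (Bundle.Trivial (Quiver.Total X) 𝕜 ×ᵇ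
        Bundle.Trivial (Quiver.Total X) 𝕜) => (z.snd.1 : 𝕜) := h1.snd
    have h4 : Continuous fun z : TotalSpace (𝕜 × 𝕜) (Bundle.Trivial (Quiver.Total X) 𝕜 ×ᵇ
        Bundle.Trivial (Quiver.Total X) 𝕜) => (z.snd.2 : 𝕜) := h2.snd
    exact (continuous_fst.comp h1).prodMk (h3.add h4)
  continuous_smul := by
    rw [(trivial_inducing 𝕜 X).continuous_iff]
    have h := (trivial_inducing 𝕜 X).continuous.comp
      (continuous_snd (X := 𝕜) (Y := TotalSpace 𝕜 (Bundle.Trivial (Quiver.Total X) 𝕜)))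
    exact (continuous_fst.comp h).prodMk (continuous_fst.mul (continuous_snd.comp h))
  continuous_norm :=
    (_root_.continuous_norm (E := 𝕜)).comp
      (continuous_snd.comp (trivial_inducing 𝕜 X).continuous)
  mul := fun _ => LinearMap.mul 𝕜 𝕜
  continuous_mul := by
    rw [(trivial_inducing 𝕜 X).continuous_iff]
    have h := (trivial_inducing 𝕜 X).continuous
    have h1 := h.comp (continuous_fst.comp (continuous_subtype_val
      (p := fun z : TotalSpace 𝕜 (Bundle.Trivial (Quiver.Total X) 𝕜) ×
        TotalSpace 𝕜 (Bundle.Trivial (Quiver.Total X) 𝕜) => z.1.proj.left = z.2.proj.right)))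
    have h2 := h.comp (continuous_snd.comp (continuous_subtype_val
      (p := fun z : TotalSpace 𝕜 (Bundle.Trivial (Quiver.Total X) 𝕜) ×
        TotalSpace 𝕜 (Bundle.Trivial (Quiver.Total X) 𝕜) => z.1.proj.left = z.2.proj.right)))
    refine Continuous.prodMk ?_ ((continuous_snd.comp h1).mul (continuous_snd.comp h2))
    exact IsEtaleGroupoid.continuous_comp.comp
      (((continuous_fst.comp h1).prodMk (continuous_fst.comp h2)).subtype_mk fun z => z.2)
  mul_assoc := fun _ _ _ _ a b c => _root_.mul_assoc (G := 𝕜) a b c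
  norm_mul := fun _ a b => _root_.norm_mul (α := 𝕜) a b
  star := fun _ => (starLinearEquiv 𝕜 (A := 𝕜)).toLinearMap
  continuous_star := by
    rw [(trivial_inducing 𝕜 X).continuous_iff]
    have h := (trivial_inducing 𝕜 X).continuous
    exact (IsEtaleGroupoid.continuous_inv.comp (continuous_fst.comp h)).prodMk
      (RCLike.continuous_conj.comp (continuous_snd.comp h))
  star_star := by
    intro γ z
    have h := Arr.inv_inv γ
    have hz : starRingEnd 𝕜 (starRingEnd 𝕜 z) = z := RCLike.conj_conj (R := 𝕜) z
    exact (Bundle.TotalSpace.toProd (Quiver.Total X) 𝕜).injective (Prod.ext h hz)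
  norm_star := fun _ z => RCLike.norm_conj (K := 𝕜) z
  star_mul := fun _ a b => (map_mul (starRingEnd 𝕜) (a : 𝕜) b).trans (mul_comm _ _)
  mul_star_self := fun _ _ z b =>
    congrArg (fun c : 𝕜 => c * b) (RCLike.mul_conj (K := 𝕜) z)

end Trivial
end Twist

/-!
By Hölder's inequality with weights `‖f‖` (the Schur test), convolution by `f` has norm at most
`normD f ^ (1/p) * normR f ^ (1/q) ≤ normI f ≤ maxNorm f` on `ℓ^p`, so it extends to the
completion. The value of `f * ξ` at point masses `ξ` over units recovers `f`, which gives
injectivity, and for `p = 1` it gives the norm `normD f`. The multiplication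
`L_{γ⁻¹} × L_γ → L_{d(γ)} ≅ 𝕜` pairs the fibers of the opposite twist with those of `L`. With
respect to it, convolution by `f̌` on `ℓ^q` is the transpose of convolution by `f` on `ℓ^p`.
Hence the two operators have the same norm, which makes `f ↦ f̌` isometric and reduces the case
`p = ∞` to the case `p = 1`.
-/

universe w'

section SchurTest

variable {ι κ : Type*}

theorem rpow_tsum_mul_le (w x : ι → ℝ≥0∞) {t : ℝ} (ht : 1 ≤ t) :
    (∑' i, w i * x i) ^ t ≤ (∑' i, w i) ^ (t - 1) * ∑' i, w i * x i ^ t := by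
  have ht0 : 0 < t := zero_lt_one.trans_le ht
  refine le_of_tendsto' (ENNReal.summable.hasSum.ennrpow_const t) fun s => ?_
  calc (∑ i ∈ s, w i * x i) ^ t
      ≤ ((∑ i ∈ s, w i) ^ (1 - t⁻¹) * (∑ i ∈ s, w i * x i ^ t) ^ t⁻¹) ^ t :=
        ENNReal.rpow_le_rpow (ENNReal.inner_le_weight_mul_Lp_of_nonneg s ht w x) ht0.le
    _ = (∑ i ∈ s, w i) ^ (t - 1) * ∑ i ∈ s, w i * x i ^ t := by
        rw [ENNReal.mul_rpow_of_nonneg _ _ ht0.le, ← ENNReal.rpow_mul, ← ENNReal.rpow_mul,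
          inv_mul_cancel₀ ht0.ne', ENNReal.rpow_one, sub_mul, inv_mul_cancel₀ ht0.ne', one_mul]
    _ ≤ (∑' i, w i) ^ (t - 1) * ∑' i, w i * x i ^ t := by
        gcongr <;> exact ENNReal.sum_le_tsum s

theorem tsum_rpow_tsum_mul_le_of_schur {k : κ → ι → ℝ≥0∞} {A B : ℝ≥0∞}
    (hrow : ∀ j, ∑' i, k j i ≤ A) (hcol : ∀ i, ∑' j, k j i ≤ B) (x : ι → ℝ≥0∞) {t : ℝ}
    (ht : 1 ≤ t) :
    ∑' j, (∑' i, k j i * x i) ^ t ≤ A ^ (t - 1) * B * ∑' i, x i ^ t :=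
  calc ∑' j, (∑' i, k j i * x i) ^ t
      ≤ ∑' j, A ^ (t - 1) * ∑' i, k j i * x i ^ t := by
        gcongr with j
        refine (rpow_tsum_mul_le (k j) x ht).trans ?_
        gcongr
        exact hrow j
    _ = A ^ (t - 1) * ∑' i, (∑' j, k j i) * x i ^ t := by
        rw [ENNReal.tsum_mul_left, ENNReal.tsum_comm]
        simp only [ENNReal.tsum_mul_right]
    _ ≤ A ^ (t - 1) * ∑' i, B * x i ^ t := by
        gcongr with i
        exact hcol i
    _ = A ^ (t - 1) * B * ∑' i, x i ^ t := by rw [ENNReal.tsum_mul_left, mul_assoc]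

theorem toReal_inv_add_toReal_inv (p q : ℝ≥0∞) [p.HolderConjugate q] :
    p⁻¹.toReal + q⁻¹.toReal = 1 := by
  have hp : p⁻¹ ≠ ∞ := ENNReal.inv_ne_top.2 (ENNReal.HolderConjugate.pos p q).ne'
  have hq : q⁻¹ ≠ ∞ := ENNReal.inv_ne_top.2 (ENNReal.HolderConjugate.pos q p).ne'
  rw [← ENNReal.toReal_add hp hq, ENNReal.HolderConjugate.inv_add_inv_eq_one p q,
    ENNReal.toReal_one]

variable {E : ι → Type*} [∀ i, NormedAddCommGroup (E i)] {F : κ → Type*}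
  [∀ j, NormedAddCommGroup (F j)] {p q : ℝ≥0∞} [Fact (1 ≤ p)]

theorem ofReal_norm_rpow {V : Type*} [SeminormedAddGroup V] (v : V) {t : ℝ} (ht : 0 ≤ t) :
    ENNReal.ofReal (‖v‖ ^ t) = ‖v‖ₑ ^ t := by
  rw [← ofReal_norm, ENNReal.ofReal_rpow_of_nonneg (norm_nonneg v) ht]

theorem enorm_lp_rpow_eq_tsum (hp : 0 < p.toReal) (f : lp E p) :
    ‖f‖ₑ ^ p.toReal = ∑' i, ‖f i‖ₑ ^ p.toReal := by
  rw [← ofReal_norm_rpow f hp.le, lp.norm_rpow_eq_tsum hp,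
    ENNReal.ofReal_tsum_of_nonneg (fun i => by positivity) ((lp.memℓp f).summable hp)]
  simp only [ofReal_norm_rpow _ hp.le]

theorem exists_enorm_lp_le_of_tsum_rpow_le (hp : 0 < p.toReal) {f : ∀ i, E i} {C : ℝ≥0∞}
    (hC : C ≠ ∞) (hf : ∑' i, ‖f i‖ₑ ^ p.toReal ≤ C ^ p.toReal) :
    ∃ h : Memℓp f p, ‖(⟨f, h⟩ : lp E p)‖ₑ ≤ C := by
  have hfin : ∑' i, ‖f i‖ₑ ^ p.toReal ≠ ∞ := ne_top_of_le_ne_top (by finiteness) hf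
  have h : Memℓp f p := memℓp_gen <| (ENNReal.summable_toReal hfin).congr fun i => by
    rw [← ENNReal.toReal_rpow, toReal_enorm]
  refine ⟨h, (ENNReal.rpow_le_rpow_iff hp).1 ?_⟩
  rwa [enorm_lp_rpow_eq_tsum hp]

theorem exists_enorm_lp_top_le {f : ∀ i, E i} {C : ℝ≥0∞} (hC : C ≠ ∞)
    (hf : ∀ i, ‖f i‖ₑ ≤ C) : ∃ h : Memℓp f ∞, ‖(⟨f, h⟩ : lp E ∞)‖ₑ ≤ C := by
  lift C to NNReal using hC
  have hle (i : ι) : ‖f i‖ ≤ C := mod_cast hf i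
  have h : Memℓp f ∞ := memℓp_infty ⟨C, Set.forall_mem_range.2 hle⟩
  exact ⟨h, mod_cast lp.norm_le_of_forall_le (f := ⟨f, h⟩) C.coe_nonneg hle⟩

theorem exists_enorm_lp_le_of_schur [p.HolderConjugate q] {k : κ → ι → ℝ≥0∞} {A B : ℝ≥0∞}
    (hrow : ∀ j, ∑' i, k j i ≤ A) (hcol : ∀ i, ∑' j, k j i ≤ B)
    (hAB : B ^ p⁻¹.toReal * A ^ q⁻¹.toReal ≠ ∞) (f : lp E p) {g : ∀ j, F j}
    (hg : ∀ j, ‖g j‖ₑ ≤ ∑' i, k j i * ‖f i‖ₑ) :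
    ∃ h : Memℓp g p,
      ‖(⟨g, h⟩ : lp F p)‖ₑ ≤ B ^ p⁻¹.toReal * A ^ q⁻¹.toReal * ‖f‖ₑ := by
  have hfin : B ^ p⁻¹.toReal * A ^ q⁻¹.toReal * ‖f‖ₑ ≠ ∞ := ENNReal.mul_ne_top hAB enorm_ne_top
  obtain rfl | hp := eq_or_ne p ∞
  · obtain rfl : q = 1 := ENNReal.HolderConjugate.unique ∞ q 1
    refine exists_enorm_lp_top_le hfin fun j => ?_
    calc ‖g j‖ₑ ≤ ∑' i, k j i * ‖f‖ₑ := (hg j).trans <| by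
          gcongr with i
          exact enorm_le_iff_norm_le.2 (lp.norm_apply_le_norm ENNReal.top_ne_zero f i)
      _ ≤ A * ‖f‖ₑ := by
          rw [ENNReal.tsum_mul_right]
          gcongr
          exact hrow j
      _ = B ^ (∞ : ℝ≥0∞)⁻¹.toReal * A ^ (1 : ℝ≥0∞)⁻¹.toReal * ‖f‖ₑ := by simp
  · have hp1 : 1 ≤ p.toReal := by
      simpa using ENNReal.toReal_mono hp (Fact.out : 1 ≤ p)
    have hp0 : 0 < p.toReal := zero_lt_one.trans_le hp1
    have hpp : p⁻¹.toReal * p.toReal = 1 := by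
      rw [ENNReal.toReal_inv, inv_mul_cancel₀ hp0.ne']
    have hqp : q⁻¹.toReal * p.toReal = p.toReal - 1 := by
      linear_combination p.toReal * toReal_inv_add_toReal_inv p q - hpp
    refine exists_enorm_lp_le_of_tsum_rpow_le hp0 hfin ?_
    calc ∑' j, ‖g j‖ₑ ^ p.toReal ≤ ∑' j, (∑' i, k j i * ‖f i‖ₑ) ^ p.toReal := by
          gcongr with j
          exact hg j
      _ ≤ A ^ (p.toReal - 1) * B * ∑' i, ‖f i‖ₑ ^ p.toReal :=
          tsum_rpow_tsum_mul_le_of_schur hrow hcol _ hp1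
      _ = (B ^ p⁻¹.toReal * A ^ q⁻¹.toReal * ‖f‖ₑ) ^ p.toReal := by
          rw [ENNReal.mul_rpow_of_nonneg _ _ hp0.le, ENNReal.mul_rpow_of_nonneg _ _ hp0.le,
            ← ENNReal.rpow_mul, ← ENNReal.rpow_mul, hpp, hqp, ENNReal.rpow_one,
            enorm_lp_rpow_eq_tsum hp0, mul_comm B]

end SchurTest

section Transpose

variable {ι 𝕜 : Type*} [DecidableEq ι] [RCLike 𝕜] {E F : ι → Type*}
  [∀ i, NormedAddCommGroup (E i)] [∀ i, NormedSpace 𝕜 (E i)]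
  [∀ i, NormedAddCommGroup (F i)] [∀ i, NormedSpace 𝕜 (F i)]
  {p q : ℝ≥0∞} [Fact (1 ≤ p)] [Fact (1 ≤ q)] [p.HolderConjugate q]

theorem norm_sum_lp_single_le_one {s : Finset ι} {e : ∀ i, E i} (hp : p ≠ ∞)
    (he : ∑ i ∈ s, ‖e i‖ ^ p.toReal ≤ 1) : ‖∑ i ∈ s, (lp.single p i (e i) : lp E p)‖ ≤ 1 := by
  have hp0 : 0 < p.toReal := ENNReal.toReal_pos (zero_lt_one.trans_le Fact.out).ne' hp
  rw [← lp.norm_sum_single hp0] at he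
  exact (Real.rpow_le_rpow_iff (norm_nonneg _) zero_le_one hp0).1 (by rwa [Real.one_rpow])

theorem norm_sum_lp_top_single_le_one {s : Finset ι} {e : ∀ i, E i} (he : ∀ i, ‖e i‖ ≤ 1) :
    ‖∑ i ∈ s, (lp.single ∞ i (e i) : lp E ∞)‖ ≤ 1 := by
  refine lp.norm_le_of_forall_le zero_le_one fun j => ?_
  rw [lp.coeFn_sum, Finset.sum_apply]
  simp only [lp.coeFn_single, Finset.sum_pi_single]
  split_ifs
  · exact he j
  · simp

theorem norm_lp_le_of_forall_norm_sum_pairing_le {B : ∀ i, F i →L[𝕜] E i →L[𝕜] 𝕜}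
    (hB : ∀ i (y : F i), ∃ e : E i, ‖e‖ ≤ 1 ∧ B i y e = (‖y‖ : 𝕜)) (y : lp F q) {C : ℝ}
    (hC : 0 ≤ C)
    (hy : ∀ (s : Finset ι) (e : ∀ i, E i), ‖∑ i ∈ s, (lp.single p i (e i) : lp E p)‖ ≤ 1 →
      ‖∑ i ∈ s, B i (y i) (e i)‖ ≤ C) : ‖y‖ ≤ C := by
  choose e he hBe using fun i => hB i (y i)
  have hsum (s : Finset ι) (g : ι → NNReal)
      (hg : ‖∑ i ∈ s, (lp.single p i (((g i : ℝ) : 𝕜) • e i) : lp E p)‖ ≤ 1) :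
      ∑ i ∈ s, ‖y i‖ * g i ≤ C := by
    refine (le_abs_self _).trans ((RCLike.norm_ofReal (K := 𝕜) _).symm.trans_le ?_)
    simpa [hBe, mul_comm] using hy s _ hg
  have hge (g : ι → NNReal) (i : ι) : ‖((g i : ℝ) : 𝕜) • e i‖ ≤ g i := by
    rw [norm_smul, RCLike.norm_ofReal, NNReal.abs_eq]
    exact mul_le_of_le_one_right (g i).2 (he i)
  obtain rfl | hq := eq_or_ne q ∞
  · obtain rfl : p = 1 := ENNReal.HolderConjugate.unique ∞ p 1
    refine lp.norm_le_of_forall_le hC fun i => ?_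
    simpa using hsum {i} 1 (norm_sum_lp_single_le_one ENNReal.one_ne_top (by simpa using he i))
  have hq0 : 0 < q.toReal := ENNReal.toReal_pos (zero_lt_one.trans_le Fact.out).ne' hq
  refine lp.norm_le_of_forall_sum_le hq0 hC fun s => ?_
  obtain rfl | hp := eq_or_ne p ∞
  · obtain rfl : q = 1 := ENNReal.HolderConjugate.unique ∞ q 1
    simpa using hsum s 1 (norm_sum_lp_top_single_le_one (hge 1))
  · have hqp : q.toReal.HolderConjugate p.toReal :=
      ENNReal.HolderConjugate.toReal_of_ne_top hq hp
    obtain ⟨g, hg, hgs⟩ := (NNReal.isGreatest_Lp s (fun i => ‖y i‖₊) hqp).1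
    have hgs' : ∑ i ∈ s, ‖y i‖ * g i = (∑ i ∈ s, ‖y i‖ ^ q.toReal) ^ q.toReal⁻¹ := by
      simpa using congrArg NNReal.toReal hgs
    refine (Real.rpow_inv_le_iff_of_pos (by positivity) hC hq0).1 (hgs' ▸ hsum s g ?_)
    refine norm_sum_lp_single_le_one hp (le_trans ?_ (NNReal.coe_le_coe.2 hg))
    push_cast
    gcongr with i
    exact hge g i

theorem opNorm_le_of_transpose {B : ∀ i, F i →L[𝕜] E i →L[𝕜] 𝕜} (hB1 : ∀ i, ‖B i‖ ≤ 1)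
    (hB : ∀ i (y : F i), ∃ e : E i, ‖e‖ ≤ 1 ∧ B i y e = (‖y‖ : 𝕜))
    (R : lp E p →L[𝕜] lp E p) (S : lp F q →L[𝕜] lp F q)
    (hRS : ∀ (y : lp F q) i (e : E i),
      ∑' j, B j (y j) ((R (lp.single p i e) : ∀ j, E j) j) = B i ((S y : ∀ i, F i) i) e) :
    ‖S‖ ≤ ‖R‖ := by
  have : q.HolderConjugate p := .symm
  let P : lp F q →L[𝕜] lp E p →L[𝕜] 𝕜 := lp.dualPairing q p (K := 1) B hB1
  refine S.opNorm_le_bound (norm_nonneg R) fun y => ?_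
  refine norm_lp_le_of_forall_norm_sum_pairing_le (p := p) hB (S y) (by positivity)
    fun s e he => ?_
  calc ‖∑ i ∈ s, B i ((S y : ∀ i, F i) i) (e i)‖ = ‖P y (R (∑ i ∈ s, lp.single p i (e i)))‖ := by
        simp only [map_sum, ← hRS]
        rfl
    _ ≤ 1 * ‖y‖ * (‖R‖ * 1) :=
        P.le_of_opNorm₂_le_of_le (lp.norm_dualPairing (K := 1) B hB1) le_rfl
          (R.le_of_opNorm_le_of_le le_rfl he)
    _ = ‖R‖ * ‖y‖ := by ring

end Transpose

theorem enorm_finsum_le_tsum {ι V : Type*} [NormedAddCommGroup V] (f : ι → V) :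
    ‖∑ᶠ i, f i‖ₑ ≤ ∑' i, ‖f i‖ₑ := by
  by_cases hf : f.support.Finite
  · rw [finsum_eq_sum f hf]
    exact (enorm_sum_le _ _).trans (ENNReal.sum_le_tsum _)
  · simp [finsum_of_infinite_support hf]

namespace Twist

section NormEstimates

variable {𝕜 : Type} [RCLike 𝕜] {X : Type u} [TopologicalSpace X] [Groupoid.{v} X]
  [TopologicalSpace (Quiver.Total X)] {L : Twist.{u, v, w} 𝕜 X}

theorem enorm_mul {α β γ : Quiver.Total X} (h : Arr.IsComp α β γ) (a : L.fiber α)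
    (b : L.fiber β) : ‖L.mul h a b‖ₑ = ‖a‖ₑ * ‖b‖ₑ := by
  simp only [← ofReal_norm, L.norm_mul, ENNReal.ofReal_mul (norm_nonneg a)]

/-- The kernel `(γ, β) ↦ |f(γβ⁻¹)|` of the operator `ξ ↦ f * ξ`, extended by `0` to the pairs with
`d(γ) ≠ d(β)`. The sum ranges over at most one arrow, `α = γβ⁻¹`. -/
noncomputable def convKernel (f : L.Section) (γ β : Quiver.Total X) : ℝ≥0∞ :=
  ∑' α : {α : Quiver.Total X // Arr.IsComp α β γ}, ‖f α‖ₑ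

theorem tsum_convKernel_le_normR (f : L.Section) (γ : Quiver.Total X) :
    ∑' β, convKernel f γ β ≤ L.normR f := by
  let φ : (Σ β, {α : Quiver.Total X // Arr.IsComp α β γ}) →
      {α : Quiver.Total X // α.right = γ.right} := fun z => ⟨z.2, z.2.2.right_eq.symm⟩
  have hφ : Function.Injective φ := by
    rintro ⟨β, α, h⟩ ⟨β', α', h'⟩ heq
    obtain rfl : α = α' := congrArg Subtype.val heq
    obtain rfl := h.unique_right h'
    rfl
  calc ∑' β, convKernel f γ β
      = ∑' z : Σ β, {α : Quiver.Total X // Arr.IsComp α β γ}, ‖f z.2‖ₑ :=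
        (ENNReal.tsum_sigma _).symm
    _ ≤ ∑' α : {α : Quiver.Total X // α.right = γ.right}, ‖f α‖ₑ :=
        ENNReal.tsum_comp_le_tsum_of_injective hφ fun α => ‖f α‖ₑ
    _ ≤ L.normR f :=
        le_iSup (fun x => ∑' α : {α : Quiver.Total X // α.right = x}, ‖f α‖ₑ) γ.right

theorem tsum_convKernel_le_normD (f : L.Section) (β : Quiver.Total X) :
    ∑' γ, convKernel f γ β ≤ L.normD f := by
  let φ : (Σ γ, {α : Quiver.Total X // Arr.IsComp α β γ}) →
      {α : Quiver.Total X // α.left = β.right} := fun z => ⟨z.2, z.2.2.1⟩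
  have hφ : Function.Injective φ := by
    rintro ⟨γ, α, h⟩ ⟨γ', α', h'⟩ heq
    obtain rfl : α = α' := congrArg Subtype.val heq
    obtain rfl := h.unique h'
    rfl
  calc ∑' γ, convKernel f γ β
      = ∑' z : Σ γ, {α : Quiver.Total X // Arr.IsComp α β γ}, ‖f z.2‖ₑ :=
        (ENNReal.tsum_sigma _).symm
    _ ≤ ∑' α : {α : Quiver.Total X // α.left = β.right}, ‖f α‖ₑ :=
        ENNReal.tsum_comp_le_tsum_of_injective hφ fun α => ‖f α‖ₑ
    _ ≤ L.normD f :=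
        le_iSup (fun x => ∑' α : {α : Quiver.Total X // α.left = x}, ‖f α‖ₑ) β.right

theorem enorm_conv_le_tsum_convKernel_mul (f ξ : L.Section) (γ : Quiver.Total X) :
    ‖L.conv f ξ γ‖ₑ ≤ ∑' β, convKernel f γ β * ‖ξ β‖ₑ := by
  let φ : {η : Quiver.Total X // η.right = γ.right} →
      Σ β, {α : Quiver.Total X // Arr.IsComp α β γ} :=
    fun η => ⟨Arr.ldiv η γ η.2, η, Arr.isComp_ldiv _ _ η.2⟩
  have hφ : Function.Injective φ := fun η η' heq => Subtype.ext (congrArg (fun z => z.2.1) heq)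
  calc ‖L.conv f ξ γ‖ₑ
      ≤ ∑' η : {η : Quiver.Total X // η.right = γ.right}, ‖f η‖ₑ * ‖ξ (Arr.ldiv η γ η.2)‖ₑ := by
        simp only [conv, ← enorm_mul (Arr.isComp_ldiv _ _ _)]
        exact enorm_finsum_le_tsum _
    _ ≤ ∑' z : Σ β, {α : Quiver.Total X // Arr.IsComp α β γ}, ‖f z.2‖ₑ * ‖ξ z.1‖ₑ :=
        ENNReal.tsum_comp_le_tsum_of_injective hφ fun z => ‖f z.2‖ₑ * ‖ξ z.1‖ₑ
    _ = ∑' β, convKernel f γ β * ‖ξ β‖ₑ := by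
        simp only [convKernel, ← ENNReal.tsum_mul_right]
        exact ENNReal.tsum_sigma fun β (α : {α : Quiver.Total X // Arr.IsComp α β γ}) =>
          ‖f α‖ₑ * ‖ξ β‖ₑ

theorem IsCcOn.tsum_fiber_le {U : Set (Quiver.Total X)} {g : L.Section} (hg : L.IsCcOn U g)
    {e : Quiver.Total X → X} (he : Set.InjOn e U) (x : X) :
    ∑' γ : {γ : Quiver.Total X // e γ = x}, ‖g γ‖ₑ ≤ ENNReal.ofReal (⨆ γ, ‖g γ‖) := by
  by_cases hne : ∃ γ : {γ : Quiver.Total X // e γ = x}, g γ ≠ 0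
  · obtain ⟨γ, hγ⟩ := hne
    have hzero (γ' : {γ : Quiver.Total X // e γ = x}) (hne : γ' ≠ γ) : ‖g γ'‖ₑ = 0 := by
      by_contra h0
      exact hne <| Subtype.ext <| he (hg.mem_of_ne (enorm_ne_zero.1 h0)) (hg.mem_of_ne hγ)
        (γ'.2.trans γ.2.symm)
    rw [tsum_eq_single γ hzero, ← ofReal_norm]
    exact ENNReal.ofReal_le_ofReal (le_ciSup hg.bddAbove γ.1)
  · push Not at hne
    simp [hne]

theorem tsum_fiber_le_maxNorm {f : L.Section} (hf : f ∈ L.Cc) {e : Quiver.Total X → X}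
    (he : ∀ U : Set (Quiver.Total X), IsBisection U → Set.InjOn e U) (x : X) :
    ∑' γ : {γ : Quiver.Total X // e γ = x}, ‖f γ‖ₑ ≤ ENNReal.ofReal (L.maxNorm f) := by
  refine le_of_forall_gt_imp_ge_of_dense fun t ht => ?_
  obtain rfl | htop := eq_or_ne t ∞
  · exact le_top
  obtain ⟨n, U, g, hg, rfl, hlt⟩ := exists_lt_of_maxNorm_lt hf
    ((ENNReal.ofReal_lt_iff_lt_toReal (maxNorm_nonneg f) htop).1 ht)
  calc ∑' γ : {γ : Quiver.Total X // e γ = x}, ‖(∑ k, g k) γ‖ₑ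
      ≤ ∑' γ : {γ : Quiver.Total X // e γ = x}, ∑ k, ‖g k γ‖ₑ := by
        gcongr with γ
        rw [Finset.sum_apply]
        exact enorm_sum_le _ _
    _ = ∑ k, ∑' γ : {γ : Quiver.Total X // e γ = x}, ‖g k γ‖ₑ :=
        Summable.tsum_finsetSum fun _ _ => ENNReal.summable
    _ ≤ ∑ k, ENNReal.ofReal (⨆ γ, ‖g k γ‖) :=
        Finset.sum_le_sum fun k _ => (hg k).2.tsum_fiber_le (he _ (hg k).1) x
    _ = ENNReal.ofReal (∑ k, ⨆ γ, ‖g k γ‖) :=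
        (ENNReal.ofReal_sum_of_nonneg fun k _ => Real.iSup_nonneg fun _ => norm_nonneg _).symm
    _ ≤ t := ENNReal.ofReal_le_of_le_toReal hlt.le

theorem normI_le_maxNorm {f : L.Section} (hf : f ∈ L.Cc) :
    L.normI f ≤ ENNReal.ofReal (L.maxNorm f) :=
  max_le (iSup_le <| tsum_fiber_le_maxNorm hf fun _ hU => hU.injOn_left)
    (iSup_le <| tsum_fiber_le_maxNorm hf fun _ hU => hU.injOn_right)

theorem normD_rpow_mul_normR_rpow_le_normI (p q : ℝ≥0∞) [p.HolderConjugate q] (f : L.Section) :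
    L.normD f ^ p⁻¹.toReal * L.normR f ^ q⁻¹.toReal ≤ L.normI f :=
  calc L.normD f ^ p⁻¹.toReal * L.normR f ^ q⁻¹.toReal
      ≤ L.normI f ^ p⁻¹.toReal * L.normI f ^ q⁻¹.toReal := by
        gcongr
        exacts [le_max_left _ _, le_max_right _ _]
    _ = L.normI f := by
        rw [← ENNReal.rpow_add_of_nonneg _ _ ENNReal.toReal_nonneg ENNReal.toReal_nonneg,
          toReal_inv_add_toReal_inv p q, ENNReal.rpow_one]

theorem exists_enorm_conv_le {p q : ℝ≥0∞} [Fact (1 ≤ p)] [p.HolderConjugate q] {f : L.Section}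
    (hf : f ∈ L.Cc) (ξ : L.ellP p) :
    ∃ h : Memℓp (L.conv f ξ) p, ‖(⟨L.conv f ξ, h⟩ : L.ellP p)‖ₑ ≤
      L.normD f ^ p⁻¹.toReal * L.normR f ^ q⁻¹.toReal * ‖ξ‖ₑ :=
  exists_enorm_lp_le_of_schur (tsum_convKernel_le_normR f) (tsum_convKernel_le_normD f)
    (ne_top_of_le_ne_top ENNReal.ofReal_ne_top <|
      (normD_rpow_mul_normR_rpow_le_normI p q f).trans (normI_le_maxNorm hf))
    ξ (enorm_conv_le_tsum_convKernel_mul f ξ)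

end NormEstimates

end Twist

theorem NonUnitalCompletion.exists_contractive_extension {𝕜 A B : Type*} [NormedField 𝕜]
    [NonUnitalSeminormedRing A] [NormedSpace 𝕜 A] [NonUnitalNormedRing B] [NormedSpace 𝕜 B]
    [CompleteSpace B] (φ : A →ₙₐ[𝕜] B) (hφ : ∀ a, ‖φ a‖ ≤ ‖a‖) :
    ∃ Φ : UniformSpace.Completion A →ₙₐ[𝕜] B, (∀ a, ‖Φ a‖ ≤ ‖a‖) ∧ ∀ a : A, Φ a = φ a := by
  let ι := (UniformSpace.Completion.toComplL : A →L[𝕜] UniformSpace.Completion A).toLinearMap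
  have hι : DenseRange ι := UniformSpace.Completion.denseRange_coe
  have hφι (a : A) : ‖(φ : A →ₗ[𝕜] B) a‖ ≤ 1 * ‖ι a‖ := by
    rw [one_mul]
    exact (hφ a).trans_eq (UniformSpace.Completion.norm_coe a).symm
  let Ψ := (φ : A →ₗ[𝕜] B).extendOfNorm ι
  have hΨ (a : A) : Ψ a = φ a := LinearMap.extendOfNorm_eq hι ⟨1, hφι⟩ a
  have hmul (a b : UniformSpace.Completion A) : Ψ (a * b) = Ψ a * Ψ b := by
    refine UniformSpace.Completion.induction_on₂ a b
      (isClosed_eq (by fun_prop) (by fun_prop)) fun a b => ?_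
    rw [← NonUnitalCompletion.coe_mul, hΨ, hΨ, hΨ, map_mul]
  exact ⟨{ Ψ with map_zero' := map_zero Ψ, map_mul' := hmul },
    fun a => (LinearMap.norm_extendOfNorm_apply_le hι 1 hφι a).trans_eq (one_mul _), hΨ⟩

namespace Arr

variable {X : Type u} [Groupoid.{v} X]

theorem IsComp.unique_left {α α' β γ : Quiver.Total X} (h : IsComp α β γ)
    (h' : IsComp α' β γ) : α = α' :=
  inv_injective (h.inv.unique_right h'.inv)

theorem isComp_unit_right (γ : Quiver.Total X) : IsComp γ (unit γ.left) γ :=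
  isComp_iff.2 ⟨_, _, _, 𝟙 _, γ.hom, rfl, rfl, by simp⟩

end Arr

namespace Twist

section RegularRepresentation

variable {𝕜 : Type} [RCLike 𝕜] {X : Type u} [TopologicalSpace X] [Groupoid.{v} X]
  [TopologicalSpace (Quiver.Total X)] {L : Twist.{u, v, w} 𝕜 X}

theorem completeSpace_fiber (L : Twist.{u, v, w} 𝕜 X) (γ : Quiver.Total X) :
    CompleteSpace (L.fiber γ) :=
  have : FiniteDimensional 𝕜 (L.fiber γ) :=
    Module.finite_of_finrank_pos (by rw [L.finrank_fiber]; exact one_pos)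
  FiniteDimensional.complete 𝕜 _

theorem exists_norm_eq_one (L : Twist.{u, v, w} 𝕜 X) (γ : Quiver.Total X) :
    ∃ e : L.fiber γ, ‖e‖ = 1 := by
  have : Nontrivial (L.fiber γ) :=
    Module.nontrivial_of_finrank_pos (R := 𝕜) (by rw [L.finrank_fiber]; exact one_pos)
  obtain ⟨z, hz⟩ := exists_ne (0 : L.fiber γ)
  exact ⟨(‖z‖⁻¹ : 𝕜) • z, norm_smul_inv_norm hz⟩

theorem conv_eq_of_unique_right {f g : L.Section} {α β γ : Quiver.Total X}
    (h : Arr.IsComp α β γ) (hg : ∀ β', g β' ≠ 0 → β' = β) :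
    L.conv f g γ = L.mul h (f α) (g β) := by
  have hr := h.right_eq
  obtain rfl : β = Arr.ldiv α γ hr.symm := h.unique_right (Arr.isComp_ldiv _ _ _)
  refine finsum_eq_single _ (⟨α, hr.symm⟩ : {η : Quiver.Total X // η.right = γ.right})
    fun η hη => ?_
  have hcomp := Arr.isComp_ldiv η.1 γ η.2
  have hzero : g (Arr.ldiv η.1 γ η.2) = 0 := by
    by_contra hne
    rw [hg _ hne] at hcomp
    exact hη (Subtype.ext (hcomp.unique_left h))
  rw [hzero, map_zero]

theorem conv_single_apply [DecidableEq (Quiver.Total X)] (f : L.Section) {α β γ : Quiver.Total X}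
    (h : Arr.IsComp α β γ) (b : L.fiber β) :
    L.conv f (Pi.single β b) γ = L.mul h (f α) b := by
  rw [conv_eq_of_unique_right h fun β' hβ' => ?_, Pi.single_eq_same]
  by_contra hne
  exact hβ' (Pi.single_eq_of_ne hne b)

theorem exists_norm_conv_le {p : ℝ≥0∞} [Fact (1 ≤ p)] {f : L.Section} (hf : f ∈ L.Cc)
    (ξ : L.ellP p) :
    ∃ h : Memℓp (L.conv f ξ) p, ‖(⟨L.conv f ξ, h⟩ : L.ellP p)‖ ≤ L.maxNorm f * ‖ξ‖ := by
  obtain ⟨hmem, hle⟩ := exists_enorm_conv_le (q := p.conjExponent) hf ξ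
  refine ⟨hmem, (ENNReal.ofReal_le_ofReal_iff (by have := maxNorm_nonneg f; positivity)).1 ?_⟩
  rw [ofReal_norm, ENNReal.ofReal_mul (maxNorm_nonneg f), ofReal_norm]
  refine hle.trans ?_
  gcongr
  exact (normD_rpow_mul_normR_rpow_le_normI _ _ f).trans (normI_le_maxNorm hf)

variable [IsEtaleGroupoid X] [T2Space X] {p : ℝ≥0∞} [Fact (1 ≤ p)]

/-- The operator `ξ ↦ f * ξ` on `ℓ^p(G, L)`. -/
noncomputable def convOp (p : ℝ≥0∞) [Fact (1 ≤ p)] (f : L.CcAlg) : L.ellP p →L[𝕜] L.ellP p :=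
  LinearMap.mkContinuous
    { toFun ξ := ⟨L.conv f.val ξ, (exists_norm_conv_le f.mem ξ).1⟩
      map_add' _ _ := lp.ext (conv_add_right f.mem _ _)
      map_smul' c _ := lp.ext (conv_smul_right c f.val _) }
    ‖f‖ fun ξ => (exists_norm_conv_le f.mem ξ).2

theorem norm_convOp_le (f : L.CcAlg) : ‖convOp p f‖ ≤ ‖f‖ :=
  LinearMap.mkContinuous_norm_le _ (norm_nonneg f) _

/-- The left regular representation of `𝔠_c(G, L)` on `ℓ^p(G, L)`. -/
noncomputable def convHom (L : Twist.{u, v, w} 𝕜 X) (p : ℝ≥0∞) [Fact (1 ≤ p)] :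
    L.CcAlg →ₙₐ[𝕜] (L.ellP p →L[𝕜] L.ellP p) where
  toFun := convOp p
  map_smul' c f := ContinuousLinearMap.ext fun _ => lp.ext (conv_smul_left c f.val _)
  map_zero' := ContinuousLinearMap.ext fun _ => lp.ext (conv_zero_left _)
  map_add' f g := ContinuousLinearMap.ext fun _ => lp.ext (conv_add_left f.mem g.mem _)
  map_mul' f g := ContinuousLinearMap.ext fun _ => lp.ext (conv_assoc f.mem g.mem _)

theorem exists_isRegularRep (L : Twist.{u, v, w} 𝕜 X) (p : ℝ≥0∞) [Fact (1 ≤ p)] :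
    ∃ Λ : L.BanachAlg →ₙₐ[𝕜] (L.ellP p →L[𝕜] L.ellP p), IsRegularRep Λ := by
  have := L.completeSpace_fiber
  obtain ⟨Λ, hΛ, hcoe⟩ :=
    NonUnitalCompletion.exists_contractive_extension (L.convHom p) norm_convOp_le
  exact ⟨Λ, hΛ, fun f ξ => congrArg (fun T => (T ξ : L.Section)) (hcoe f)⟩

namespace IsRegularRep

variable {Λ : L.BanachAlg →ₙₐ[𝕜] (L.ellP p →L[𝕜] L.ellP p)}

theorem unique (hΛ : IsRegularRep Λ) {Λ' : L.BanachAlg →ₙₐ[𝕜] (L.ellP p →L[𝕜] L.ellP p)}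
    (hΛ' : IsRegularRep Λ') : Λ = Λ' := by
  have hcont {Λ : L.BanachAlg →ₙₐ[𝕜] (L.ellP p →L[𝕜] L.ellP p)} (hΛ : IsRegularRep Λ) :
      Continuous Λ :=
    AddMonoidHomClass.continuous_of_bound Λ 1 fun a => (hΛ.norm_le a).trans_eq (one_mul _).symm
  refine NonUnitalAlgHom.ext fun a => UniformSpace.Completion.induction_on a
    (isClosed_eq (hcont hΛ) (hcont hΛ')) fun f => ContinuousLinearMap.ext fun ξ => lp.ext ?_
  exact (hΛ.apply_eq f ξ).trans (hΛ'.apply_eq f ξ).symm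

theorem enorm_le (hΛ : IsRegularRep Λ) (q : ℝ≥0∞) [p.HolderConjugate q] (f : L.CcAlg) :
    ‖Λ (L.toBanachAlg f)‖ₑ ≤ L.normD f.val ^ p⁻¹.toReal * L.normR f.val ^ q⁻¹.toReal := by
  refine ContinuousLinearMap.opENorm_le_bound _ fun ξ => ?_
  obtain ⟨hmem, hle⟩ := exists_enorm_conv_le (q := q) f.mem ξ
  rwa [show Λ (L.toBanachAlg f) ξ = ⟨L.conv f.val ξ, hmem⟩ from lp.ext (hΛ.apply_eq f ξ)]

theorem apply_single [DecidableEq (Quiver.Total X)] (hΛ : IsRegularRep Λ) (f : L.CcAlg)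
    {α β γ : Quiver.Total X} (h : Arr.IsComp α β γ) (b : L.fiber β) :
    (Λ (L.toBanachAlg f) (lp.single p β b) : L.Section) γ = L.mul h (f.val α) b := by
  rw [hΛ.apply_eq, lp.coeFn_single, conv_single_apply]

theorem injective (hΛ : IsRegularRep Λ) :
    Function.Injective fun f : L.CcAlg => Λ (L.toBanachAlg f) := by
  classical
  intro f g hfg
  refine CcAlg.ext (funext fun γ => ?_)
  obtain ⟨e, he⟩ := L.exists_norm_eq_one (Arr.unit γ.left)
  have hγ := Arr.isComp_unit_right γ
  have hmul : L.mul hγ (f.val γ - g.val γ) e = 0 := by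
    rw [map_sub, LinearMap.sub_apply, ← hΛ.apply_single f hγ, ← hΛ.apply_single g hγ, sub_eq_zero]
    exact congrArg (fun T => (T (lp.single p _ e) : L.Section) γ) hfg
  have hnorm : ‖f.val γ - g.val γ‖ = 0 := by
    rw [← mul_one ‖_‖, ← he, ← L.norm_mul hγ, hmul, norm_zero]
  exact sub_eq_zero.1 (norm_eq_zero.1 hnorm)

theorem enorm_eq_normD {Λ : L.BanachAlg →ₙₐ[𝕜] (L.ellP 1 →L[𝕜] L.ellP 1)}
    (hΛ : IsRegularRep Λ) (f : L.CcAlg) : ‖Λ (L.toBanachAlg f)‖ₑ = L.normD f.val := by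
  classical
  refine le_antisymm (by simpa using hΛ.enorm_le ∞ f) (iSup_le fun x => ?_)
  obtain ⟨e, he⟩ := L.exists_norm_eq_one (Arr.unit x)
  have he' : ‖e‖ₑ = 1 := by rw [← ofReal_norm, he, ENNReal.ofReal_one]
  set T := Λ (L.toBanachAlg f)
  let ξ : L.ellP 1 := lp.single 1 (Arr.unit x) e
  have hξ : ‖ξ‖ₑ = 1 := by rw [← ofReal_norm, lp.norm_single one_pos, he, ENNReal.ofReal_one]
  calc ∑' γ : {γ : Quiver.Total X // γ.left = x}, ‖f.val γ‖ₑ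
      = ∑' γ : {γ : Quiver.Total X // γ.left = x}, ‖(T ξ : L.Section) γ‖ₑ := by
        refine tsum_congr ?_
        rintro ⟨γ, rfl⟩
        rw [hΛ.apply_single f (Arr.isComp_unit_right γ), enorm_mul, he', mul_one]
    _ ≤ ∑' γ, ‖(T ξ : L.Section) γ‖ₑ :=
        ENNReal.tsum_comp_le_tsum_of_injective Subtype.val_injective _
    _ = ‖T ξ‖ₑ := by simpa using (enorm_lp_rpow_eq_tsum (by simp) (T ξ)).symm
    _ ≤ ‖T‖ₑ * ‖ξ‖ₑ := T.le_opENorm ξ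
    _ = ‖T‖ₑ := by rw [hξ, mul_one]

end IsRegularRep

end RegularRepresentation

end Twist

/-! ## Duality of regular representations -/

namespace Arr

variable {X : Type u} [Groupoid.{v} X]

theorem inv_involutive : Function.Involutive (inv : Quiver.Total X → Quiver.Total X) :=
  inv_inv

theorem IsComp.inv_left {α β γ : Quiver.Total X} (h : IsComp α β γ) : IsComp (Arr.inv α) γ β := by
  obtain ⟨x, y, z, g, f, rfl, rfl, rfl⟩ := isComp_iff.1 h
  exact isComp_iff.2 ⟨_, _, _, _, _, rfl, rfl, by simp⟩

theorem isComp_inv_self (γ : Quiver.Total X) : IsComp (inv γ) γ (unit γ.left) :=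
  isComp_iff.2 ⟨_, _, _, γ.hom, Groupoid.inv γ.hom, rfl, rfl, by simp [unit]⟩

theorem IsComp.ldiv_eq {α β γ : Quiver.Total X} (h : IsComp α β γ) (hr : α.right = γ.right) :
    ldiv α γ hr = β :=
  (isComp_ldiv α γ hr).unique_right h

theorem ldiv_injective (γ : Quiver.Total X) :
    Function.Injective fun η : {η : Quiver.Total X // η.right = γ.right} => ldiv η.1 γ η.2 := by
  rintro ⟨η, hη⟩ ⟨η', hη'⟩ (heq : ldiv η γ hη = ldiv η' γ hη')
  have h := isComp_ldiv η γ hη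
  rw [heq] at h
  exact Subtype.ext (h.unique_left (isComp_ldiv η' γ hη'))

theorem isComp_inv_ldiv_inv (η γ : Quiver.Total X) (h : η.right = (inv γ).right) :
    IsComp (inv (ldiv η (inv γ) h)) (inv η) γ := by
  simpa only [inv_inv] using (isComp_ldiv η (inv γ) h).inv

theorem inv_ldiv_inv_bijective (γ : Quiver.Total X) :
    Function.Bijective fun η : {η : Quiver.Total X // η.right = (inv γ).right} =>
      (⟨inv (ldiv η.1 (inv γ) η.2), (isComp_inv_ldiv_inv η.1 γ η.2).right_eq.symm⟩ :
        {η : Quiver.Total X // η.right = γ.right}) := by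
  refine ⟨fun η η' heq => ldiv_injective _ (inv_injective (Subtype.ext_iff.1 heq)), ?_⟩
  rintro ⟨η, hη⟩
  have h := (isComp_ldiv η γ hη).inv
  exact ⟨⟨inv (ldiv η γ hη), h.right_eq.symm⟩,
    Subtype.ext (by simp only [h.ldiv_eq, inv_inv])⟩

end Arr

namespace Twist

variable {𝕜 : Type} [RCLike 𝕜] {X : Type u} [TopologicalSpace X] [Groupoid.{v} X]
  [TopologicalSpace (Quiver.Total X)]

section Adjoint

variable {L : Twist.{u, v, w} 𝕜 X} {L' : Twist.{u, v, w'} 𝕜 X}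
  {B : ∀ γ, L'.fiber γ →ₗ[𝕜] L.fiber γ →ₗ[𝕜] 𝕜}

/-- Convolution by `f` and convolution by `f'` are adjoint to each other with respect to the
fiberwise pairing `B`. -/
def IsAdjointPair (B : ∀ γ, L'.fiber γ →ₗ[𝕜] L.fiber γ →ₗ[𝕜] 𝕜) (f : L.Section)
    (f' : L'.Section) : Prop :=
  ∀ ⦃α α' β γ : Quiver.Total X⦄ (h : Arr.IsComp α β γ) (h' : Arr.IsComp α' γ β)
    (a : L'.fiber γ) (b : L.fiber β), B γ a (L.mul h (f α) b) = B β (L'.mul h' (f' α') a) b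

theorem IsAdjointPair.flip {f : L.Section} {f' : L'.Section} (h : IsAdjointPair B f f') :
    IsAdjointPair (fun γ => (B γ).flip) f' f :=
  fun _ _ _ _ h₁ h₂ a b => (h h₂ h₁ b a).symm

theorem conv_single_eq_zero [DecidableEq (Quiver.Total X)] (f : L.Section)
    {β γ : Quiver.Total X} (h : ∀ α, ¬ Arr.IsComp α β γ) (b : L.fiber β) :
    L.conv f (Pi.single β b) γ = 0 := by
  refine conv_eq_zero fun α β' hc _ => Pi.single_eq_of_ne (fun heq => h α ?_) b
  rwa [← heq]

theorem IsAdjointPair.tsum_pairing_conv_single [DecidableEq (Quiver.Total X)] {f : L.Section}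
    {f' : L'.Section} (h : IsAdjointPair B f f') (hf' : f' ∈ L'.Cc) (ξ : L'.Section)
    (β : Quiver.Total X) (b : L.fiber β) :
    ∑' γ, B γ (ξ γ) (L.conv f (Pi.single β b) γ) = B β (L'.conv f' ξ β) b := by
  let term (η : {η : Quiver.Total X // η.right = β.right}) : L'.fiber β :=
    L'.mul (Arr.isComp_ldiv η.1 β η.2) (f' η.1) (ξ (Arr.ldiv η.1 β η.2))
  have hterm (η : {η : Quiver.Total X // η.right = β.right}) :
      B _ (ξ (Arr.ldiv η.1 β η.2)) (L.conv f (Pi.single β b) (Arr.ldiv η.1 β η.2)) =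
        (B β).flip b (term η) := by
    have hcomp := Arr.isComp_ldiv η.1 β η.2
    rw [conv_single_apply f hcomp.inv_left, h hcomp.inv_left hcomp, LinearMap.flip_apply]
  have hsupp : (Function.support fun γ => B γ (ξ γ) (L.conv f (Pi.single β b) γ)) ⊆
      Set.range fun η : {η : Quiver.Total X // η.right = β.right} => Arr.ldiv η.1 β η.2 := by
    refine Function.support_subset_iff'.2 fun γ hγ => ?_
    rw [conv_single_eq_zero f (fun α hα => hγ ?_) b, map_zero]
    exact ⟨⟨Arr.inv α, hα.inv_left.right_eq.symm⟩, hα.inv_left.ldiv_eq _⟩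
  have hfin : term.HasFiniteSupport := finite_conv_support hf' ξ β
  calc ∑' γ, B γ (ξ γ) (L.conv f (Pi.single β b) γ)
      = ∑' η, (B β).flip b (term η) := by
        rw [← (Arr.ldiv_injective β).tsum_eq hsupp]
        exact tsum_congr hterm
    _ = ∑ᶠ η, (B β).flip b (term η) :=
        tsum_eq_finsum (hfin.subset (Function.support_comp_subset (map_zero _) _))
    _ = (B β).flip b (∑ᶠ η, term η) := (map_finsum _ hfin).symm

theorem exists_pairing_eq_norm (hB : ∀ γ a b, ‖B γ a b‖ = ‖a‖ * ‖b‖) (γ : Quiver.Total X)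
    (y : L'.fiber γ) : ∃ e : L.fiber γ, ‖e‖ = 1 ∧ B γ y e = (‖y‖ : 𝕜) := by
  obtain ⟨e, he⟩ := L.exists_norm_eq_one γ
  obtain ⟨c, hc, hcB⟩ := RCLike.exists_norm_eq_mul_self (B γ y e)
  refine ⟨c • e, by rw [norm_smul, hc, he, mul_one], ?_⟩
  rw [map_smul, smul_eq_mul, ← hcB, hB, he, mul_one]

variable [IsEtaleGroupoid X] [T2Space X] {p q : ℝ≥0∞} [Fact (1 ≤ p)] [Fact (1 ≤ q)]
  [p.HolderConjugate q] {Λ : L.BanachAlg →ₙₐ[𝕜] (L.ellP p →L[𝕜] L.ellP p)}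
  {Λ' : L'.BanachAlg →ₙₐ[𝕜] (L'.ellP q →L[𝕜] L'.ellP q)} {f : L.CcAlg} {f' : L'.CcAlg}

theorem IsAdjointPair.norm_regularRep_le (h : IsAdjointPair B f.val f'.val)
    (hB : ∀ γ a b, ‖B γ a b‖ = ‖a‖ * ‖b‖) (hΛ : IsRegularRep Λ) (hΛ' : IsRegularRep Λ') :
    ‖Λ' (L'.toBanachAlg f')‖ ≤ ‖Λ (L.toBanachAlg f)‖ := by
  classical
  let Bc (γ : Quiver.Total X) : L'.fiber γ →L[𝕜] L.fiber γ →L[𝕜] 𝕜 :=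
    (B γ).mkContinuous₂ 1 fun a b => by rw [hB, one_mul]
  refine opNorm_le_of_transpose (B := Bc)
    (fun γ => LinearMap.mkContinuous₂_norm_le _ zero_le_one _) (fun γ y => ?_) _ _
    fun ξ β b => ?_
  · obtain ⟨e, he, hye⟩ := exists_pairing_eq_norm hB γ y
    exact ⟨e, he.le, hye⟩
  · rw [hΛ.apply_eq, hΛ'.apply_eq, lp.coeFn_single]
    exact h.tsum_pairing_conv_single f'.mem ξ β b

theorem IsAdjointPair.norm_regularRep_eq (h : IsAdjointPair B f.val f'.val)
    (hB : ∀ γ a b, ‖B γ a b‖ = ‖a‖ * ‖b‖) (hΛ : IsRegularRep Λ) (hΛ' : IsRegularRep Λ') :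
    ‖Λ' (L'.toBanachAlg f')‖ = ‖Λ (L.toBanachAlg f)‖ :=
  have : q.HolderConjugate p := .symm
  le_antisymm (h.norm_regularRep_le hB hΛ hΛ')
    (h.flip.norm_regularRep_le (fun γ a b => (hB γ b a).trans (mul_comm _ _)) hΛ' hΛ)

end Adjoint

/-- An isomorphism from the opposite of the twist `L` to `L'`. The bundle `L.op` carries the
topology pulled back from `L` along inversion, so that a homeomorphism of the total spaces is
encoded by `isInducing`. -/
structure AntiIso (L : Twist.{u, v, w} 𝕜 X) (L' : Twist.{u, v, w'} 𝕜 X) where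
  toLin : ∀ γ, L.fiber (Arr.inv γ) ≃ₗᵢ[𝕜] L'.fiber γ
  isInducing : IsInducing fun z : TotalSpace 𝕜 L'.fiber =>
    (⟨Arr.inv z.proj, (toLin z.proj).symm z.snd⟩ : TotalSpace 𝕜 L.fiber)
  map_mul : ∀ {α β γ : Quiver.Total X} (h : Arr.IsComp α β γ) (a : L.fiber (Arr.inv α))
    (b : L.fiber (Arr.inv β)), L'.mul h (toLin α a) (toLin β b) = toLin γ (L.mul h.inv b a)

theorem exists_norm_preserving_functional (L : Twist.{u, v, w} 𝕜 X) (γ : Quiver.Total X) :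
    ∃ φ : L.fiber γ →ₗ[𝕜] 𝕜, ∀ z, ‖φ z‖ = ‖z‖ := by
  obtain ⟨e, he⟩ := L.exists_norm_eq_one γ
  have he0 : ‖e‖ ≠ 0 := by rw [he]; exact one_ne_zero
  obtain ⟨φ, -, hφe⟩ := exists_dual_vector 𝕜 e he0
  refine ⟨φ, fun z => ?_⟩
  obtain ⟨c, rfl⟩ :=
    (finrank_eq_one_iff_of_nonzero' e (norm_ne_zero_iff.1 he0)).1 (L.finrank_fiber γ) z
  rw [map_smul, norm_smul, norm_smul, ContinuousLinearMap.coe_coe, hφe, RCLike.norm_ofReal,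
    abs_norm]

namespace AntiIso

variable {L : Twist.{u, v, w} 𝕜 X} {L' : Twist.{u, v, w'} 𝕜 X}

/-- The map `f ↦ f̌`, `f̌(γ) = f(γ⁻¹)`, on sections. -/
def check (T : AntiIso L L') : L.Section ≃ₗ[𝕜] L'.Section :=
  (LinearEquiv.piCongrLeft' 𝕜 L.fiber (Arr.inv_involutive.toPerm)).trans
    (LinearEquiv.piCongrRight fun γ => (T.toLin γ).toLinearEquiv)

theorem check_apply (T : AntiIso L L') (f : L.Section) (γ : Quiver.Total X) :
    T.check f γ = T.toLin γ (f (Arr.inv γ)) :=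
  rfl

theorem conv_check (T : AntiIso L L') (f g : L.Section) :
    L'.conv (T.check g) (T.check f) = T.check (L.conv f g) := by
  funext γ
  rw [check_apply]
  refine ((AddEquivClass.map_finsum (T.toLin γ) _).trans
    (finsum_eq_of_bijective _ (Arr.inv_ldiv_inv_bijective γ) fun η => ?_)).symm
  have hcomp := Arr.isComp_inv_ldiv_inv η.1 γ η.2
  rw [check_apply, check_apply, T.map_mul]
  congr 1
  refine L.mul_congr ?_ ?_ _ _
  · rw [hcomp.ldiv_eq, Arr.inv_inv]
  · rw [Arr.inv_inv]

theorem exists_isAdjointPair (T : AntiIso L L') :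
    ∃ B : ∀ γ, L'.fiber γ →ₗ[𝕜] L.fiber γ →ₗ[𝕜] 𝕜,
      (∀ γ a b, ‖B γ a b‖ = ‖a‖ * ‖b‖) ∧ ∀ f, IsAdjointPair B f (T.check f) := by
  choose φ hφ using L.exists_norm_preserving_functional
  -- `L'_γ` is `L_{γ⁻¹}`, and the pairing is `(a, b) ↦ a b ∈ L_{d(γ)} ≅ 𝕜`.
  let B (γ : Quiver.Total X) : L'.fiber γ →ₗ[𝕜] L.fiber γ →ₗ[𝕜] 𝕜 :=
    ((L.mul (Arr.isComp_inv_self γ)).compr₂ (φ _)).comp (T.toLin γ).symm.toLinearEquiv.toLinearMap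
  have hB (γ : Quiver.Total X) (a : L.fiber (Arr.inv γ)) (b : L.fiber γ) :
      B γ (T.toLin γ a) b = φ _ (L.mul (Arr.isComp_inv_self γ) a b) :=
    congrArg (fun a => φ _ (L.mul (Arr.isComp_inv_self γ) a b)) ((T.toLin γ).symm_apply_apply a)
  refine ⟨B, fun γ a b => ?_, fun f α α' β γ h h' a b => ?_⟩
  · obtain ⟨a, rfl⟩ := (T.toLin γ).surjective a
    rw [hB, hφ, L.norm_mul, LinearIsometryEquiv.norm_map]
  · obtain ⟨a, rfl⟩ := (T.toLin γ).surjective a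
    obtain ⟨x, y, z, g, k, rfl, rfl, rfl⟩ := Arr.isComp_iff.1 h
    obtain rfl := h'.unique_left h.inv_left
    have h₁ := h'.inv
    rw [Arr.inv_inv] at h₁
    rw [check_apply, T.map_mul, hB, hB,
      ← L.mul_assoc h₁ (Arr.isComp_inv_self _) h (Arr.isComp_inv_self _)]
    refine congrArg (fun c => φ _ (L.mul (Arr.isComp_inv_self _) c b)) (L.mul_congr rfl ?_ _ _)
    exact congrArg (fun α => (⟨α, f α⟩ : TotalSpace 𝕜 L.fiber)) (Arr.inv_inv _).symm

theorem normD_check (T : AntiIso L L') (f : L.Section) : L'.normD (T.check f) = L.normR f := by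
  refine iSup_congr fun x => ?_
  let e : {γ : Quiver.Total X // γ.left = x} ≃ {γ : Quiver.Total X // γ.right = x} :=
    Arr.inv_involutive.toPerm.subtypeEquiv fun _ => Iff.rfl
  rw [← e.tsum_eq]
  exact tsum_congr fun γ => (T.toLin γ.1).enorm_map _

section Etale

variable [IsEtaleGroupoid X]

/-- Inversion as a homeomorphism of the space of arrows. -/
def _root_.Arr.invHomeomorph (X : Type u) [TopologicalSpace X] [Groupoid.{v} X]
    [TopologicalSpace (Quiver.Total X)] [IsEtaleGroupoid X] :
    Quiver.Total X ≃ₜ Quiver.Total X where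
  toEquiv := Arr.inv_involutive.toPerm
  continuous_toFun := IsEtaleGroupoid.continuous_inv
  continuous_invFun := IsEtaleGroupoid.continuous_inv

theorem _root_.IsBisection.preimage_inv {U : Set (Quiver.Total X)} (hU : IsBisection U) :
    IsBisection (Arr.inv ⁻¹' U) :=
  .of_injOn (hU.isOpen.preimage IsEtaleGroupoid.continuous_inv)
    (fun _ hγ _ hγ' h => Arr.inv_injective (hU.injOn_right hγ hγ' h))
    (fun _ hγ _ hγ' h => Arr.inv_injective (hU.injOn_left hγ hγ' h))

theorem continuousOn_check_iff (T : AntiIso L L') {U : Set (Quiver.Total X)} {f : L.Section} :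
    ContinuousOn (fun γ => (⟨γ, T.check f γ⟩ : TotalSpace 𝕜 L'.fiber)) (Arr.inv ⁻¹' U) ↔
      ContinuousOn (fun γ => (⟨γ, f γ⟩ : TotalSpace 𝕜 L.fiber)) U := by
  rw [T.isInducing.continuousOn_iff]
  simp only [Function.comp_def, check_apply, LinearIsometryEquiv.symm_apply_apply]
  refine ⟨fun h => ?_, fun h => h.comp IsEtaleGroupoid.continuous_inv.continuousOn fun _ h => h⟩
  refine (h.comp IsEtaleGroupoid.continuous_inv.continuousOn fun γ hγ => ?_).congr fun γ _ => ?_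
  · rwa [Set.mem_preimage, Arr.inv_inv]
  · rw [Function.comp_apply, Arr.inv_inv]

theorem isCcOn_check_iff (T : AntiIso L L') {U : Set (Quiver.Total X)} {f : L.Section} :
    L'.IsCcOn (Arr.inv ⁻¹' U) (T.check f) ↔ L.IsCcOn U f := by
  have hsurj := (Arr.invHomeomorph X).surjective
  have hcompact : (∃ K ⊆ Arr.inv ⁻¹' U, IsCompact K ∧ ∀ γ ∉ K, T.check f γ = 0) ↔
      ∃ K ⊆ U, IsCompact K ∧ ∀ γ ∉ K, f γ = 0 := by
    rw [Arr.inv_injective.preimage_surjective.exists]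
    refine exists_congr fun K => and_congr hsurj.preimage_subset_preimage_iff
      (and_congr (Arr.invHomeomorph X).isCompact_preimage ?_)
    exact (forall₂_congr fun γ _ => (T.toLin γ).map_eq_zero_iff).trans
      (hsurj.forall (p := fun γ => γ ∉ K → f γ = 0)).symm
  exact ⟨fun h => ⟨T.continuousOn_check_iff.1 h.continuousOn, hcompact.1 h.compact⟩,
    fun h => ⟨T.continuousOn_check_iff.2 h.continuousOn, hcompact.2 h.compact⟩⟩

theorem map_check_Cc (T : AntiIso L L') : L.Cc.map T.check.toLinearMap = L'.Cc := by
  refine (Submodule.map_span _ _).trans (congrArg (Submodule.span 𝕜) ?_)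
  refine Set.Subset.antisymm ?_ fun g ⟨U, hU, hgU⟩ => ?_
  · rintro _ ⟨f, ⟨U, hU, hfU⟩, rfl⟩
    exact ⟨_, hU.preimage_inv, T.isCcOn_check_iff.2 hfU⟩
  · obtain ⟨f, rfl⟩ := T.check.surjective g
    refine ⟨f, ⟨_, hU.preimage_inv, T.isCcOn_check_iff.1 ?_⟩, rfl⟩
    rwa [← Set.preimage_comp, Arr.inv_involutive.comp_self]

/-- The map `f ↦ f̌` as a linear equivalence of convolution algebras. -/
def checkEquiv (T : AntiIso L L') : L.CcAlg ≃ₗ[𝕜] L'.CcAlg :=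
  T.check.ofSubmodules L.Cc L'.Cc T.map_check_Cc

theorem checkEquiv_mul [T2Space X] (T : AntiIso L L') (f g : L.CcAlg) :
    T.checkEquiv (f * g) = T.checkEquiv g * T.checkEquiv f :=
  CcAlg.ext (T.conv_check f.val g.val).symm

end Etale

end AntiIso

end Twist

/-! ## Reduced algebras -/

theorem exists_opposite_linearIsometryEquiv {𝕜 A A' R R' : Type*} [NormedField 𝕜]
    [NonUnitalNonAssocRing A] [Module 𝕜 A] [NonUnitalNonAssocRing A'] [Module 𝕜 A']
    [NonUnitalNormedRing R] [Module 𝕜 R] [IsBoundedSMul 𝕜 R] [CompleteSpace R]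
    [NonUnitalNormedRing R'] [Module 𝕜 R'] [IsBoundedSMul 𝕜 R'] [CompleteSpace R']
    (c : A ≃ₗ[𝕜] A') (hc : ∀ f g, c (f * g) = c g * c f) {e : A →ₙₐ[𝕜] R} {e' : A' →ₙₐ[𝕜] R'}
    (he : DenseRange e) (he' : DenseRange e') (hnorm : ∀ f, ‖e' (c f)‖ = ‖e f‖) :
    ∃ Φ : Rᵐᵒᵖ ≃ₗᵢ[𝕜] R', (∀ a b, Φ (a * b) = Φ a * Φ b) ∧
      ∀ f, Φ (MulOpposite.op (e f)) = e' (c f) := by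
  let _ : NormedSpace 𝕜 R := ⟨norm_smul_le⟩
  let _ : NormedSpace 𝕜 R' := ⟨norm_smul_le⟩
  let e₁ : A →ₗ[𝕜] Rᵐᵒᵖ := (MulOpposite.opLinearEquiv 𝕜).toLinearMap ∘ₗ (e : A →ₗ[𝕜] R)
  have he₁ : DenseRange e₁ :=
    MulOpposite.op_surjective.denseRange.comp he MulOpposite.continuous_op
  let Φ := c.extendOfIsometry e₁ (e' : A' →ₗ[𝕜] R') he₁ he' hnorm
  have hΦ (f : A) : Φ (e₁ f) = e' (c f) := c.extendOfIsometry_eq e₁ _ he₁ he' hnorm f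
  have hcont : Continuous Φ := Φ.continuous
  refine ⟨Φ, he₁.induction_on₂ (isClosed_eq (by fun_prop) (by fun_prop)) fun f g => ?_, hΦ⟩
  have hmul : e₁ f * e₁ g = e₁ (g * f) := congrArg MulOpposite.op (map_mul e g f).symm
  rw [hmul, hΦ, hΦ, hΦ, hc, map_mul]

theorem isBoundedSMul_nonUnitalSubalgebra {𝕜 A : Type*} [NormedCommRing 𝕜]
    [NonUnitalNormedRing A] [Module 𝕜 A] [IsBoundedSMul 𝕜 A] (S : NonUnitalSubalgebra 𝕜 A) :
    IsBoundedSMul 𝕜 S :=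
  .of_norm_smul_le fun c a => norm_smul_le c a.1

namespace Twist

variable {𝕜 : Type} [RCLike 𝕜] {X : Type u} [TopologicalSpace X] [Groupoid.{v} X]
  [TopologicalSpace (Quiver.Total X)] [IsEtaleGroupoid X]

/-- The identity map as an isomorphism from the opposite of `L` to `L.op`. -/
def opAntiIso (L : Twist.{u, v, w} 𝕜 X) : AntiIso L L.op where
  toLin γ := LinearIsometryEquiv.refl 𝕜 (L.fiber (Arr.inv γ))
  isInducing := ⟨rfl⟩
  map_mul _ _ _ := rfl

/-- The identification of the trivial twist with its opposite. -/
def trivialAntiIso (𝕜 : Type) [RCLike 𝕜] (X : Type u) [TopologicalSpace X] [Groupoid.{v} X]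
    [TopologicalSpace (Quiver.Total X)] [IsEtaleGroupoid X] :
    AntiIso (trivial 𝕜 X) (trivial 𝕜 X) where
  toLin _ := LinearIsometryEquiv.refl 𝕜 𝕜
  isInducing := by
    have h := trivial_inducing 𝕜 X
    exact h.of_comp_iff.1 (((Arr.invHomeomorph X).isInducing.prodMap IsInducing.id).comp h)
  map_mul _ a b := mul_comm (G := 𝕜) a b

section ClosedImage

variable [T2Space X] {L : Twist.{u, v, w} 𝕜 X} {E : Type*} [NormedAddCommGroup E]
  [NormedSpace 𝕜 E] (Λ : L.BanachAlg →ₙₐ[𝕜] (E →L[𝕜] E))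

/-- `toClosedImage Λ` as a homomorphism of algebras. -/
noncomputable def toClosedImageHom : L.CcAlg →ₙₐ[𝕜] closedImage Λ :=
  NonUnitalAlgHom.codRestrict (Λ.comp L.toBanachAlg) _ fun f => (toClosedImage Λ f).2

theorem denseRange_toClosedImageHom : DenseRange (toClosedImageHom Λ) := by
  rintro ⟨a, ha⟩
  rw [closure_subtype, ← Set.range_comp]
  exact ha

theorem completeSpace_closedImage [CompleteSpace E] : CompleteSpace (closedImage Λ) :=
  (NonUnitalSubalgebra.isClosed_topologicalClosure _).completeSpace_coe

end ClosedImage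

namespace AntiIso

variable {L : Twist.{u, v, w} 𝕜 X} {L' : Twist.{u, v, w'} 𝕜 X}

variable [T2Space X] {p q : ℝ≥0∞} [Fact (1 ≤ p)] [Fact (1 ≤ q)] [p.HolderConjugate q]
  {Λ : L.BanachAlg →ₙₐ[𝕜] (L.ellP p →L[𝕜] L.ellP p)}
  {Λ' : L'.BanachAlg →ₙₐ[𝕜] (L'.ellP q →L[𝕜] L'.ellP q)}

theorem norm_regularRep_checkEquiv (T : AntiIso L L') (hΛ : IsRegularRep Λ)
    (hΛ' : IsRegularRep Λ') (f : L.CcAlg) :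
    ‖Λ' (L'.toBanachAlg (T.checkEquiv f))‖ = ‖Λ (L.toBanachAlg f)‖ := by
  obtain ⟨B, hB, hadj⟩ := T.exists_isAdjointPair
  exact IsAdjointPair.norm_regularRep_eq (f' := T.checkEquiv f) (hadj f.val) hB hΛ hΛ'

theorem exists_opposite_closedImage_equiv (T : AntiIso L L') (hΛ : IsRegularRep Λ)
    (hΛ' : IsRegularRep Λ') : ∃ Φ : (closedImage Λ)ᵐᵒᵖ ≃ₗᵢ[𝕜] closedImage Λ',
      (∀ a b, Φ (a * b) = Φ a * Φ b) ∧
      ∀ f : L.CcAlg, Φ (MulOpposite.op (toClosedImage Λ f)) =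
        toClosedImage Λ' (T.checkEquiv f) := by
  have := L.completeSpace_fiber
  have := L'.completeSpace_fiber
  have := completeSpace_closedImage Λ
  have := completeSpace_closedImage Λ'
  have := isBoundedSMul_nonUnitalSubalgebra (closedImage Λ)
  have := isBoundedSMul_nonUnitalSubalgebra (closedImage Λ')
  have hnorm (f : L.CcAlg) :
      ‖toClosedImageHom Λ' (T.checkEquiv f)‖ = ‖toClosedImageHom Λ f‖ :=
    T.norm_regularRep_checkEquiv hΛ hΛ' f
  exact exists_opposite_linearIsometryEquiv T.checkEquiv T.checkEquiv_mul
    (denseRange_toClosedImageHom Λ) (denseRange_toClosedImageHom Λ') hnorm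

end AntiIso

theorem IsRegularRep.enorm_eq_normR [T2Space X] {L : Twist.{u, v, w} 𝕜 X}
    {Λ : L.BanachAlg →ₙₐ[𝕜] (L.ellP ∞ →L[𝕜] L.ellP ∞)} (hΛ : IsRegularRep Λ) (f : L.CcAlg) :
    ‖Λ (L.toBanachAlg f)‖ₑ = L.normR f.val := by
  obtain ⟨Λ', hΛ'⟩ := L.op.exists_isRegularRep 1
  calc ‖Λ (L.toBanachAlg f)‖ₑ = ‖Λ' (L.op.toBanachAlg (L.opAntiIso.checkEquiv f))‖ₑ := by
        rw [← ofReal_norm, ← ofReal_norm, L.opAntiIso.norm_regularRep_checkEquiv hΛ hΛ']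
    _ = L.op.normD (L.opAntiIso.check f.val) := hΛ'.enorm_eq_normD _
    _ = L.normR f.val := L.opAntiIso.normD_check f.val

end Twist

theorem mainTheorem12_general {𝕜 : Type} [RCLike 𝕜] {X : Type u} [TopologicalSpace X] [T2Space X]
    [Groupoid.{v} X] [TopologicalSpace (Quiver.Total X)] [IsEtaleGroupoid X]
    (L : Twist.{u, v, w} 𝕜 X) (p q : ℝ≥0∞) [Fact (1 ≤ p)] [Fact (1 ≤ q)]
    (hpq : p⁻¹ + q⁻¹ = 1) :
    (∃! Λ : L.BanachAlg →ₙₐ[𝕜] (L.ellP p →L[𝕜] L.ellP p), Twist.IsRegularRep Λ) ∧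
    ∀ Λ : L.BanachAlg →ₙₐ[𝕜] (L.ellP p →L[𝕜] L.ellP p), Twist.IsRegularRep Λ →
      Function.Injective (fun f : L.CcAlg => Λ (L.toBanachAlg f)) ∧
      (∀ f : L.CcAlg,
        ‖Λ (L.toBanachAlg f)‖ₑ ≤ L.normD f.val ^ p⁻¹.toReal * L.normR f.val ^ q⁻¹.toReal ∧
        L.normD f.val ^ p⁻¹.toReal * L.normR f.val ^ q⁻¹.toReal ≤ L.normI f.val) ∧
      (p = 1 → ∀ f : L.CcAlg, ‖Λ (L.toBanachAlg f)‖ₑ = L.normD f.val) ∧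
      (p = ∞ → ∀ f : L.CcAlg, ‖Λ (L.toBanachAlg f)‖ₑ = L.normR f.val) ∧
      ∀ (L' : Twist.{u, v, w'} 𝕜 X) (T : Twist.AntiIso L L')
        (Λ' : L'.BanachAlg →ₙₐ[𝕜] (L'.ellP q →L[𝕜] L'.ellP q)), Twist.IsRegularRep Λ' →
        ∃ Φ : (Twist.closedImage Λ)ᵐᵒᵖ ≃ₗᵢ[𝕜] Twist.closedImage Λ',
          (∀ a b, Φ (a * b) = Φ a * Φ b) ∧
          ∀ f : L.CcAlg, Φ (MulOpposite.op (Twist.toClosedImage Λ f)) =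
            Twist.toClosedImage Λ' (T.checkEquiv f) := by
  have : p.HolderConjugate q := ENNReal.holderConjugate_iff.2 hpq
  obtain ⟨Λ₀, hΛ₀⟩ := L.exists_isRegularRep p
  refine ⟨⟨Λ₀, hΛ₀, fun _ hΛ => hΛ.unique hΛ₀⟩, fun Λ hΛ => ⟨hΛ.injective,
    fun f => ⟨hΛ.enorm_le q f, Twist.normD_rpow_mul_normR_rpow_le_normI p q f.val⟩, ?_, ?_,
    fun L' T Λ' hΛ' => T.exists_opposite_closedImage_equiv hΛ hΛ'⟩⟩
  · rintro rfl
    exact hΛ.enorm_eq_normD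
  · rintro rfl
    exact hΛ.enorm_eq_normR

theorem mainTheorem12 {𝕜 : Type} [RCLike 𝕜] {X : Type u} [TopologicalSpace X] [T2Space X]
    [LocallyCompactSpace X] [Groupoid.{v} X] [TopologicalSpace (Quiver.Total X)]
    [IsEtaleGroupoid X] (L : Twist.{u, v, w} 𝕜 X)
    (p q : ℝ≥0∞) [Fact (1 ≤ p)] [Fact (1 ≤ q)] (hpq : p⁻¹ + q⁻¹ = 1) :
    (∃! Λ : L.BanachAlg →ₙₐ[𝕜] (L.ellP p →L[𝕜] L.ellP p), Twist.IsRegularRep Λ) ∧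
    (∀ Λ : L.BanachAlg →ₙₐ[𝕜] (L.ellP p →L[𝕜] L.ellP p), Twist.IsRegularRep Λ →
      Function.Injective (fun f : L.CcAlg => Λ (L.toBanachAlg f)) ∧
      (∀ f : L.CcAlg,
        ‖Λ (L.toBanachAlg f)‖ₑ ≤ L.normD f.val ^ p⁻¹.toReal * L.normR f.val ^ q⁻¹.toReal ∧
        L.normD f.val ^ p⁻¹.toReal * L.normR f.val ^ q⁻¹.toReal ≤ L.normI f.val) ∧
      (p = 1 → ∀ f : L.CcAlg, ‖Λ (L.toBanachAlg f)‖ₑ = L.normD f.val) ∧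
      (p = ∞ → ∀ f : L.CcAlg, ‖Λ (L.toBanachAlg f)‖ₑ = L.normR f.val) ∧
      (∀ Λ' : L.op.BanachAlg →ₙₐ[𝕜] (L.op.ellP q →L[𝕜] L.op.ellP q), Twist.IsRegularRep Λ' →
        ∃ Φ : (Twist.closedImage Λ)ᵐᵒᵖ ≃ₗᵢ[𝕜] Twist.closedImage Λ',
          (∀ a b, Φ (a * b) = Φ a * Φ b) ∧
          ∀ f : L.CcAlg, Φ (MulOpposite.op (Twist.toClosedImage Λ f)) = Twist.toClosedImage Λ' f.check)) ∧
    (∀ (Λ : (Twist.trivial 𝕜 X).BanachAlg →ₙₐ[𝕜]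
          ((Twist.trivial 𝕜 X).ellP p →L[𝕜] (Twist.trivial 𝕜 X).ellP p))
        (Λ' : (Twist.trivial 𝕜 X).BanachAlg →ₙₐ[𝕜]
          ((Twist.trivial 𝕜 X).ellP q →L[𝕜] (Twist.trivial 𝕜 X).ellP q)),
      Twist.IsRegularRep Λ → Twist.IsRegularRep Λ' →
        ∃ Φ : (Twist.closedImage Λ)ᵐᵒᵖ ≃ₗᵢ[𝕜] Twist.closedImage Λ',
          (∀ a b, Φ (a * b) = Φ a * Φ b) ∧
          ∀ f : (Twist.trivial 𝕜 X).CcAlg, ∃ g : (Twist.trivial 𝕜 X).CcAlg,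
            (∀ γ, g.val γ = f.val (Arr.inv γ)) ∧
            Φ (MulOpposite.op (Twist.toClosedImage Λ f)) = Twist.toClosedImage Λ' g) := by
  obtain ⟨hex, hprop⟩ := mainTheorem12_general L p q hpq
  refine ⟨hex, fun Λ hΛ => ?_, fun Λ Λ' hΛ hΛ' => ?_⟩
  · obtain ⟨hinj, hbound, hone, htop, hdual⟩ := hprop Λ hΛ
    exact ⟨hinj, hbound, hone, htop, hdual L.op L.opAntiIso⟩
  · obtain ⟨-, -, -, -, hdual⟩ := (mainTheorem12_general (Twist.trivial 𝕜 X) p q hpq).2 Λ hΛ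
    obtain ⟨Φ, hmul, hΦ⟩ := hdual _ (Twist.trivialAntiIso 𝕜 X) Λ' hΛ'
    exact ⟨Φ, hmul, fun f => ⟨(Twist.trivialAntiIso 𝕜 X).checkEquiv f, fun _ => rfl, hΦ f⟩⟩
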